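/- **Model.** Let $\lambda,\tilde{\mathcal U},\rho,\theta>0$, $\sigma^2\ge 0$, $\eta>2$, $N\in\{0,1,2,\dots\}$, $q\in(0,1]$ and $c=3.575$. The back-off chain has the $N+2$ states $T$ (transmit, index $0$), $B_1,\dots,B_N$ (deterministic back-off slots) and $W$ (random back-off). For failure probability $p\in[0,1]$ its transition matrix $\mathbf P(p)$ is: from $T$, stay with probability $1-p$ and move to the next state of the list $T,B_1,\dots,B_N,W$ with probability $p$; from $B_k$, move to the next state of the list with probability $1$; from $W$, move to $T$ with probability $q$ and stay with probability $1-q$. A steady state vector of $\mathbf P(p)$ is a vector $\mathbf x$ with $\mathbf x\mathbf P(p)=\mathbf x$ and entries summing to $1$; $\mathbf x^{[0]}$ is its entry at $T$. Given a probability vector $\mathbf x$ on these states, consider a test device served by a base station at the origin of $\mathbb R^2$, under the following (approximate) network model, in which all random quantities named are independent. * The potential inter-cell interferers on the same random access sequence are located at the points $u_i$ of a homogeneous Poisson process of intensity $\tilde{\mathcal U}$. Device $i$ has a back-off state with distribution $\mathbf x$, an $\mathrm{Exp}(1)$ channel gain $h_i$, and a transmit power $P_i$ distributed as $\rho R^\eta$,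 where $R$ is the distance from a fixed point to the nearest point of a Poisson process (the base stations) of intensity $\lambda$. The interference $\mathcal I_{Inter}$ is the sum of $P_ih_i\|u_i\|^{-\eta}$ over those $i$ that are in state $T$ and satisfy $P_i\|u_i\|^{-\eta}<\rho$. * The number $\mathcal N$ of other devices in the cell of the test device is, given the cell area $A$, Poisson with mean $\tilde{\mathcal U}A$, where $A$ has the approximate Poisson-Voronoi cell area distribution, namely Gamma with shape $c$ and rate $c\lambda$. Each of these devices has a back-off state with distribution $\mathbf x$ and an $\mathrm{Exp}(1)$ gain $h'_n$, and $\mathcal I_{Intra}$ is the sum of $\rho h'_n$ over those $n\le\mathcal N$ in state $T$. * The test device has an $\mathrm{Exp}(1)$ gain $h$, and its failure probability is $p=\mathbb P\left\{\frac{\rho h}{\sigma^2+\mathcal I_{Intra}+\mathcal I_{Inter}}<\theta\right\}$. **Theorem 3.** (i) For every probability vector $\mathbf x$ the failure probability is $p=F(\mathbf x^{[0]})$, where, with the active intensity $\tilde{\mathcal U}_B=\mathbf x^{[0]}\tilde{\mathcal U}$ and $\mathcal P_B=\frac{c\lambda}{c\lambda+\tilde{\mathcal U}_B}$, $$F(\mathbf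 x^{[0]})=1-\left(\frac{\mathcal P_B(1+\theta)}{\mathcal P_B+\theta}\right)^{c}\exp\left\{-\frac{\sigma^2\theta}{\rho}-\frac{2\theta\,\tilde{\mathcal U}_B}{(\eta-2)\lambda}\;{}_2F_1\left(1,1-\tfrac2\eta;2-\tfrac2\eta;-\theta\right)\right\},$$ ${}_2F_1$ being the Gauss hypergeometric function (continued analytically to the negative half-line). (ii) There is exactly one probability vector $\mathbf x^*$ that is a steady state vector of $\mathbf P(F(\mathbf x^{*[0]}))$. Whenever the device states have a distribution $\mathbf x$ that is a steady state vector of $\mathbf P(p)$ for the resulting failure probability $p$, then $\mathbf x=\mathbf x^*$. (iii) The vector $\mathbf x^*$ is obtained by the fixed-point iteration: start with any probability vector $\mathbf x(0)$; for $i\ge1$ compute $p=F(\mathbf x(i-1)^{[0]})$ and let $\mathbf x(i)$ be the steady state vector of $\mathbf P(p)$; return $\mathbf x(i)$ as soon as $\max|\mathbf x(i)-\mathbf x(i-1)|<\epsilon$. That is, the iterates exist and are unique and converge to $\mathbf x^*$; for every $\epsilon>0$ the algorithm stops after finitely many steps; and for each fixed $\mathbf x(0)$ the returned vector converges to $\mathbf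 x^*$ as $\epsilon\to0$. -/

import Mathlib

open MeasureTheory ProbabilityTheory Filter Topology

noncomputable section

namespace Rach

/-! ## The Gauss hypergeometric function -/

/-- The Gauss hypergeometric function `₂F₁(a, b; c; z)` for real parameters with `0 < b < c` and
all real `z < 1`, by Euler's integral. Mathlib's `ordinaryHypergeometric` is the bare power series,
which has no value outside the unit disc, while the argument `-θ` below may be any negative
number. -/
def gaussHypergeometric (a b c z : ℝ) : ℝ :=
  Real.Gamma c / (Real.Gamma b * Real.Gamma (c - b)) *
    ∫ t in Set.Ioo (0 : ℝ) 1, t ^ (b - 1) * (1 - t) ^ (c - b - 1) * (1 - z * t) ^ (-a)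

/-- Sanity check: inside the unit disc, and for parameters of the shape used here, the function
above is Mathlib's hypergeometric series. -/
theorem gaussHypergeometric_eq_series {b z : ℝ} (hb : 0 < b) (hz : |z| < 1) :
    gaussHypergeometric 1 b (b + 1) z = ordinaryHypergeometric 1 b (b + 1) z := by
  have hpoch : ∀ n : ℕ, (ascPochhammer ℝ n).eval b * (b + n) =
      b * (ascPochhammer ℝ n).eval (b + 1) := by
    intro n
    induction n with
    | zero => simp
    | succ n ih =>
      rw [ascPochhammer_succ_eval, ascPochhammer_succ_eval]
      push_cast
      linear_combination (b + 1 + n) * ih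
  have hcoef : ∀ n : ℕ, ((n.factorial : ℝ)⁻¹ * (ascPochhammer ℝ n).eval 1 *
      (ascPochhammer ℝ n).eval b * ((ascPochhammer ℝ n).eval (b + 1))⁻¹) • z ^ n =
      b * (z ^ n * (1 / (b + n))) := by
    intro n
    have h1 : (ascPochhammer ℝ n).eval (b + 1) ≠ 0 := (ascPochhammer_pos n _ (by linarith)).ne'
    have h2 : (n.factorial : ℝ) ≠ 0 := by positivity
    have h3 : b + (n : ℝ) ≠ 0 := by positivity
    rw [ascPochhammer_eval_one, smul_eq_mul]
    field_simp
    linear_combination (z ^ n) * hpoch n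
  have hpow : ∀ n : ℕ, IntegrableOn (fun t : ℝ => t ^ (b - 1 + n)) (Set.Ioo 0 1) ∧
      ∫ t in Set.Ioo (0 : ℝ) 1, t ^ (b - 1 + n) = 1 / (b + n) := by
    intro n
    have hn : (-1 : ℝ) < b - 1 + n := by
      have : (0 : ℝ) ≤ n := by positivity
      linarith
    constructor
    · have := intervalIntegral.intervalIntegrable_rpow' (a := 0) (b := 1) hn
      rw [intervalIntegrable_iff_integrableOn_Ioo_of_le zero_le_one] at this
      exact this
    · rw [← integral_Ioc_eq_integral_Ioo, ← intervalIntegral.integral_of_le zero_le_one,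
        integral_rpow (Or.inl hn), Real.one_rpow, Real.zero_rpow (by linarith)]
      congr 1 <;> ring
  have hsum := hasSum_integral_of_summable_integral_norm (μ := volume.restrict (Set.Ioo (0 : ℝ) 1))
    (F := fun (n : ℕ) (t : ℝ) => z ^ n * t ^ (b - 1 + n))
    (fun n => (hpow n).1.const_mul _) (by
      refine Summable.of_nonneg_of_le (fun n => integral_nonneg fun _ => norm_nonneg _)
        (f := fun n : ℕ => (1 / b) * |z| ^ n) (fun n => ?_)
        ((summable_geometric_of_lt_one (abs_nonneg z) hz).mul_left _)
      have : ∫ t in Set.Ioo (0 : ℝ) 1, ‖z ^ n * t ^ (b - 1 + n)‖ =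
          |z| ^ n * (1 / (b + n)) := by
        rw [← (hpow n).2, ← integral_const_mul]
        refine setIntegral_congr_fun measurableSet_Ioo fun t ht => ?_
        simp only [norm_mul, norm_pow, Real.norm_eq_abs]
        rw [abs_of_nonneg (Real.rpow_nonneg ht.1.le _)]
      rw [this, mul_comm]
      gcongr
      have : (0 : ℝ) ≤ n := by positivity
      linarith)
  have hG : Real.Gamma (b + 1) / (Real.Gamma b * Real.Gamma (b + 1 - b)) = b := by
    have : Real.Gamma b ≠ 0 := (Real.Gamma_pos_of_pos hb).ne'
    rw [Real.Gamma_add_one hb.ne', add_sub_cancel_left, Real.Gamma_one]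
    field_simp
  rw [ordinaryHypergeometric_eq_tsum]
  simp only [hcoef]
  rw [tsum_mul_left, gaussHypergeometric, hG]
  congr 1
  have hint : ∀ n : ℕ, ∫ t in Set.Ioo (0 : ℝ) 1, z ^ n * t ^ (b - 1 + n) =
      z ^ n * (1 / (b + n)) := fun n => by rw [integral_const_mul, (hpow n).2]
  simp only [hint] at hsum
  rw [hsum.tsum_eq]
  refine setIntegral_congr_fun measurableSet_Ioo fun t ht => ?_
  have hzt : |z * t| < 1 := by
    rw [abs_mul, abs_of_pos ht.1]
    nlinarith [abs_nonneg z, ht.1, ht.2]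
  have : ∀ n : ℕ, z ^ n * t ^ (b - 1 + n) = t ^ (b - 1) * (z * t) ^ n := fun n => by
    rw [Real.rpow_add ht.1, Real.rpow_natCast, mul_pow]; ring
  simp only [this]
  rw [tsum_mul_left, tsum_geometric_of_abs_lt_one hzt]
  simp [Real.rpow_neg_one]

/-! ## Parameters, the back-off Markov chain, the closed form and the algorithm -/

/-- Parameters of the system: base station intensity `lam`, intensity `devInt` of the devices using
one Zadoff-Chu sequence (transmitting or not), power control threshold `rho`, SINR threshold
`theta`, noise power `noise` (i.e. `σ²`), path-loss exponent `eta`, number `N` of deterministic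
back-off slots, and probability `q` of leaving the random back-off state. -/
structure Parameters where
  lam : ℝ
  devInt : ℝ
  rho : ℝ
  theta : ℝ
  noise : ℝ
  eta : ℝ
  N : ℕ
  q : ℝ

/-- States of the back-off chain: `0` is the transmit state `T`, `1, …, N` are the deterministic
back-off slots, and the last state `N + 1` is the random back-off state `W`. -/
abbrev BackoffState (N : ℕ) : Type := Fin (N + 2)

/-- The transition matrix of the back-off chain, for RACH failure probability `p`. -/
def backoffMatrix (N : ℕ) (q p : ℝ) : Matrix (BackoffState N) (BackoffState N) ℝ :=
  Matrix.of fun i j =>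
    if i = 0 then
      if j = 0 then 1 - p else if j = 1 then p else 0
    else if i = Fin.last (N + 1) then
      if j = 0 then q else if j = Fin.last (N + 1) then 1 - q else 0
    else if (j : ℕ) = (i : ℕ) + 1 then 1 else 0

/-- The steady state equations `x P = x`, `∑ x = 1`. -/
def IsSteadyState {N : ℕ} (P : Matrix (BackoffState N) (BackoffState N) ℝ)
    (x : BackoffState N → ℝ) : Prop :=
  Matrix.vecMul x P = x ∧ ∑ i, x i = 1

/-- The constant `c = 3.575` of the approximate density of the Voronoi cell area. -/
def cellConst : ℝ := 3.575

/-- The closed form of the failure probability when the transmit state has probability `x₀`. -/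
def closedForm (prm : Parameters) (x₀ : ℝ) : ℝ :=
  let U := x₀ * prm.devInt
  let P := cellConst * prm.lam / (cellConst * prm.lam + U)
  1 - (P * (1 + prm.theta) / (P + prm.theta)) ^ cellConst *
    Real.exp (-(prm.noise * prm.theta / prm.rho) -
      2 * prm.theta * U / ((prm.eta - 2) * prm.lam) *
        gaussHypergeometric 1 (1 - 2 / prm.eta) (2 - 2 / prm.eta) (-prm.theta))

/-- `xs` is the sequence of iterates of the algorithm started at `xInit`: each step computes `p`
from the previous vector by the closed form, updates the transition matrix with it, and solves the
steady state equations. -/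
def IsIterates (prm : Parameters) (xInit : BackoffState prm.N → ℝ)
    (xs : ℕ → BackoffState prm.N → ℝ) : Prop :=
  xs 0 = xInit ∧
    ∀ i, IsSteadyState (backoffMatrix prm.N prm.q (closedForm prm (xs i 0))) (xs (i + 1))

/-- The algorithm started at `xInit` with tolerance `ε` terminates and returns `y`: the loop stops
at the first iterate whose distance to the preceding one (in the maximum norm) is below `ε`. -/
def AlgorithmReturns (prm : Parameters) (ε : ℝ) (xInit y : BackoffState prm.N → ℝ) : Prop :=
  ∃ xs, IsIterates prm xInit xs ∧ ∃ i, ‖xs (i + 1) - xs i‖ < ε ∧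
    (∀ j < i, ε ≤ ‖xs (j + 1) - xs j‖) ∧ y = xs (i + 1)

/-! ## The stochastic model -/

/-- The Euclidean plane. -/
abbrev Plane : Type := EuclideanSpace ℝ (Fin 2)

variable {Ω : Type*}

/-- The number of points of the point process `u 0, u 1, …` in the set `B`. -/
def pointCount (u : ℕ → Ω → Plane) (B : Set Plane) (ω : Ω) : ENNReal :=
  ∑' i, B.indicator (fun _ => (1 : ENNReal)) (u i ω)

/-- The random points `u 0, u 1, …` form a homogeneous Poisson point process in the plane with
intensity `r`. -/
structure IsPoissonProcess [MeasurableSpace Ω] (μ : Measure Ω) (u : ℕ → Ω → Plane) (r : ℝ) :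
    Prop where
  measurable : ∀ i, Measurable (u i)
  count_law : ∀ B : Set Plane, MeasurableSet B → volume B < ⊤ → ∀ n : ℕ,
    μ {ω | pointCount u B ω = n} = poissonMeasure (r * (volume B).toReal).toNNReal {n}
  count_indep : ∀ (m : ℕ) (B : Fin m → Set Plane), (∀ j, MeasurableSet (B j)) →
    Pairwise (fun j k => Disjoint (B j) (B k)) → iIndepFun (fun j => pointCount u (B j)) μ

/-- The random quantities of the model, seen from the base station (placed at the origin) that
serves the test device. `bs` are base station locations; `loc i`, `state i`, `power i`, `fading i`
are location, back-off state, transmit power and channel gain to the origin of the `i`-th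
potential inter-cell interferer; `cellCount` is the number of other devices in the cell of the test
device, `cellState n`, `cellFading n` are their back-off states and channel gains; `signal` is the
channel gain of the test device. -/
structure Variables (Ω : Type*) (N : ℕ) where
  bs : ℕ → Ω → Plane
  loc : ℕ → Ω → Plane
  state : ℕ → Ω → BackoffState N
  power : ℕ → Ω → ℝ
  fading : ℕ → Ω → ℝ
  cellCount : Ω → ℕ
  cellState : ℕ → Ω → BackoffState N
  cellFading : ℕ → Ω → ℝ
  signal : Ω → ℝ

/-- Labels of the independent sources of randomness. -/
inductive Source : Type
  | loc
  | state (i : ℕ)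
  | power (i : ℕ)
  | fading (i : ℕ)
  | cellCount
  | cellState (n : ℕ)
  | cellFading (n : ℕ)
  | signal

/-- The σ-algebra generated by a source; all the locations together form one source. -/
@[reducible] def Variables.sigma {N : ℕ} (V : Variables Ω N) : Source → MeasurableSpace Ω
  | .loc => MeasurableSpace.comap (fun ω i => V.loc i ω) MeasurableSpace.pi
  | .state i => MeasurableSpace.comap (V.state i) ⊤
  | .power i => MeasurableSpace.comap (V.power i) (borel ℝ)
  | .fading i => MeasurableSpace.comap (V.fading i) (borel ℝ)
  | .cellCount => MeasurableSpace.comap V.cellCount ⊤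
  | .cellState n => MeasurableSpace.comap (V.cellState n) ⊤
  | .cellFading n => MeasurableSpace.comap (V.cellFading n) (borel ℝ)
  | .signal => MeasurableSpace.comap V.signal (borel ℝ)

/-- The model of the back-off scheme in which every device is in back-off state `k` with
probability `x k`. The potential inter-cell interferers form a Poisson process with i.i.d. marks
(state, power, fading), independent of the intra-cell quantities and of the test device's gain; the
base station process matters only for the law of the powers and the approximate cell area. -/
structure IsBackoffNetwork [MeasurableSpace Ω] (prm : Parameters) (x : BackoffState prm.N → ℝ)
    (μ : Measure Ω) (V : Variables Ω prm.N) : Prop where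
  prob : IsProbabilityMeasure μ
  /-- Base stations form a Poisson process. -/
  bs_poisson : IsPoissonProcess μ V.bs prm.lam
  /-- Devices sharing the Zadoff-Chu sequence form a Poisson process. -/
  loc_poisson : IsPoissonProcess μ V.loc prm.devInt
  state_law : ∀ i, Measurable (V.state i) ∧ ∀ k, μ {ω | V.state i ω = k} = ENNReal.ofReal (x k)
  /-- Channel inversion towards the nearest base station: the power is distributed as `ρ R ^ η`,
  where `R` is the distance from a given point to the nearest base station. -/
  power_law : ∀ i, Measurable (V.power i) ∧ IdentDistrib (V.power i)
    (fun ω => prm.rho * (Metric.infDist 0 (Set.range fun k => V.bs k ω)) ^ prm.eta) μ μ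
  /-- Rayleigh fading. -/
  fading_law : ∀ i, Measurable (V.fading i) ∧ μ.map (V.fading i) = expMeasure 1
  /-- The number of devices in the cell is Poisson given the cell area, and the area has the
  approximate Voronoi cell density (Gamma with shape `c` and rate `c λ`). -/
  cellCount_law : Measurable V.cellCount ∧ ∀ n : ℕ, μ {ω | V.cellCount ω = n} =
    ∫⁻ a, poissonMeasure (prm.devInt * a).toNNReal {n} ∂(gammaMeasure cellConst (cellConst * prm.lam))
  cellState_law : ∀ n, Measurable (V.cellState n) ∧
    ∀ k, μ {ω | V.cellState n ω = k} = ENNReal.ofReal (x k)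
  cellFading_law : ∀ n, Measurable (V.cellFading n) ∧ μ.map (V.cellFading n) = expMeasure 1
  signal_law : Measurable V.signal ∧ μ.map V.signal = expMeasure 1
  indep : iIndep V.sigma μ

/-- Inter-cell interference: sum over the transmitting devices whose mean received power at the
origin is below `ρ` (they are served by another base station). -/
def interInterference (prm : Parameters) (V : Variables Ω prm.N) (ω : Ω) : ENNReal :=
  ∑' i, if V.state i ω = 0 ∧ V.power i ω * ‖V.loc i ω‖ ^ (-prm.eta) < prm.rho then
    ENNReal.ofReal (V.power i ω * V.fading i ω * ‖V.loc i ω‖ ^ (-prm.eta)) else 0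

/-- Intra-cell interference: the transmitting devices of the cell are received with mean power
`ρ`. -/
def intraInterference (prm : Parameters) (V : Variables Ω prm.N) (ω : Ω) : ENNReal :=
  ∑ n ∈ Finset.range (V.cellCount ω),
    if V.cellState n ω = 0 then ENNReal.ofReal (prm.rho * V.cellFading n ω) else 0

/-- The SINR of the test device. It is extended-valued, so that vanishing or infinite
denominators are treated correctly. -/
def sinr (prm : Parameters) (V : Variables Ω prm.N) (ω : Ω) : ENNReal :=
  ENNReal.ofReal (prm.rho * V.signal ω) /
    (ENNReal.ofReal prm.noise + intraInterference prm V ω + interInterference prm V ω)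

/-- The RACH transmission failure probability `ℙ(SINR < θ)`. -/
def failureProbability [MeasurableSpace Ω] (prm : Parameters) (μ : Measure Ω)
    (V : Variables Ω prm.N) : ℝ :=
  μ.real {ω | sinr prm V ω < ENNReal.ofReal prm.theta}

end Rach

end

/-! Part (i): Rayleigh fading turns the success probability into a Laplace transform. The test gain
is Exp(1) and independent of everything else, so given the interference the event SINR ≥ θ has
probability exp(-(θ/ρ)(σ² + I_intra + I_inter)) (`measure_le_exp`, `measure_not_sinr_lt`). This
splits into a constant noise factor and two independent factors.

For the inter-cell factor, the marks are integrated out one at a time (`lintegral_prod_marks`). This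
reduces it to the Laplace functional exp(-U ∫ (1 - g)) of an unmarked Poisson process
(`lintegral_expNeg_tsum`). A transmit power ρ R^η makes the cut-off "mean received power below ρ"
the same as "distance above R", so the plane integral scales like R². The remaining radial integral
is Euler's integral for ₂F₁ after t = y^(-η), and E R² = 1/(πλ) comes from the void probabilities of
the base stations. For the intra-cell factor, a Poisson number with Gamma mean is negative binomial,
whose generating function is a power with exponent -c (`tsum_cellCount`). The transforms are
computed with `expNeg` on [0, ∞], so infinite interference needs no separate treatment.

Parts (ii) and (iii): the steady state is explicit in p, with entry 1 / (1 + p M) at T, where M = N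
+ 1/q. The problem is therefore the scalar fixed point equation of G(x) = 1 / (1 + M F(x)). Now F =
1 - exp(-φ) with φ increasing, concave and φ(0) ≥ 0; hence F increases while F(x)/x decreases
(`isFailureCurve_closedForm`). G may be arbitrarily steep, so it need not contract |x - y|. It does
contract the relative distance |x - y| / min(x, y), by the factor M / (1 + M) < 1
(`relDist_map_le`). The intermediate value theorem gives a fixed point and the contraction gives
uniqueness and convergence. The other entries follow because the steady state depends continuously
on p. -/

noncomputable section

namespace Rach

/-! ## The steady state of the back-off chain -/

/-- The steady state vector of the back-off chain with failure probability `p`. -/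
def steadyVec (N : ℕ) (q p : ℝ) : BackoffState N → ℝ := fun i =>
  (if i = 0 then 1 else if i = Fin.last (N + 1) then p / q else p) / (1 + p * (N + 1 / q))

/-- Only T itself and W lead into T. -/
theorem backoffMatrix_zero_col (N : ℕ) (q p : ℝ) (x : BackoffState N → ℝ) :
    Matrix.vecMul x (backoffMatrix N q p) 0 = x 0 * (1 - p) + x (Fin.last (N + 1)) * q := by
  have h0 : (Fin.last (N + 1)) ≠ 0 := Fin.last_pos.ne'
  rw [Matrix.vecMul, dotProduct, Finset.sum_eq_add_of_mem (0 : BackoffState N) (Fin.last (N + 1))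
    (Finset.mem_univ _) (Finset.mem_univ _) h0.symm]
  · simp [backoffMatrix, h0]
  · intro i _ hi
    simp [backoffMatrix, hi.1, hi.2]

/-- A deterministic slot has a single predecessor, which is left with probability p if it is T and
surely otherwise. -/
theorem backoffMatrix_mid_col (N : ℕ) (q p : ℝ) (x : BackoffState N → ℝ) (k : ℕ) (hk : k < N) :
    Matrix.vecMul x (backoffMatrix N q p) ⟨k + 1, by omega⟩ =
      x ⟨k, by omega⟩ * (if k = 0 then p else 1) := by
  rw [Matrix.vecMul, dotProduct, Finset.sum_eq_single (⟨k, by omega⟩ : BackoffState N)]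
  · congr 1
    have h1 : (⟨k, by omega⟩ : BackoffState N) ≠ Fin.last (N + 1) := by
      simp [Fin.ext_iff]; omega
    have h2 : (⟨k + 1, by omega⟩ : BackoffState N) ≠ 0 := by simp [Fin.ext_iff]
    by_cases h : k = 0
    · subst h
      have e0 : (⟨0, by omega⟩ : BackoffState N) = 0 := rfl
      have e1 : (⟨0 + 1, by omega⟩ : BackoffState N) = 1 := Fin.ext (by simp)
      rw [e0, e1]
      simp [backoffMatrix]
    · have h3 : (⟨k, by omega⟩ : BackoffState N) ≠ 0 := by simpa [Fin.ext_iff] using h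
      simp [backoffMatrix, h, h1, h3]
  · intro i _ hi
    have hi' : (i : ℕ) ≠ k := fun h => hi (Fin.ext h)
    simp only [backoffMatrix, Matrix.of_apply, Fin.ext_iff, Fin.val_zero, Fin.val_one, Fin.val_last]
    split_ifs <;> first | contradiction | (exfalso; omega) | simp
  · simp

theorem backoffMatrix_last_col (N : ℕ) (q p : ℝ) (x : BackoffState N → ℝ) :
    Matrix.vecMul x (backoffMatrix N q p) (Fin.last (N + 1)) =
      x ⟨N, by omega⟩ * (if N = 0 then p else 1) + x (Fin.last (N + 1)) * (1 - q) := by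
  have h0 : (⟨N, by omega⟩ : BackoffState N) ≠ Fin.last (N + 1) := by simp [Fin.ext_iff]
  have h1 : (Fin.last (N + 1)) ≠ 0 := Fin.last_pos.ne'
  rw [Matrix.vecMul, dotProduct, Finset.sum_eq_add_of_mem (⟨N, by omega⟩ : BackoffState N)
    (Fin.last (N + 1)) (Finset.mem_univ _) (Finset.mem_univ _) h0]
  · congr 1
    · congr 1
      by_cases h : N = 0
      -- Without deterministic slots the state of index 1 is W, so T is the predecessor of W and the
      -- factor is p.
      · subst h
        have e0 : (⟨0, by omega⟩ : BackoffState 0) = 0 := rfl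
        have e1 : Fin.last (0 + 1) = (1 : BackoffState 0) := rfl
        rw [e0, e1]
        simp [backoffMatrix]
      · have h3 : (⟨N, by omega⟩ : BackoffState N) ≠ 0 := by simpa [Fin.ext_iff] using h
        simp [backoffMatrix, h, h0, h3]
    · simp [backoffMatrix, h1]
  · intro i _ hi
    have hi' : (i : ℕ) ≠ N := fun h => hi.1 (Fin.ext h)
    have hi2 := hi.2
    rw [ne_eq, Fin.ext_iff, Fin.val_last] at hi2
    simp only [backoffMatrix, Matrix.of_apply, Fin.ext_iff, Fin.val_zero, Fin.val_one, Fin.val_last]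
    split_ifs <;> first | contradiction | (exfalso; omega) | simp

theorem sum_backoffState (N : ℕ) (x : BackoffState N → ℝ) :
    ∑ i, x i = x 0 + ∑ m : Fin N, x ⟨m + 1, by omega⟩ + x (Fin.last (N + 1)) := by
  rw [Fin.sum_univ_castSucc, Fin.sum_univ_succ]
  rfl

section Steady

variable {N : ℕ} {q p : ℝ}

theorem steady_denom_pos (hq : 0 < q) (hp : 0 ≤ p) : 0 < 1 + p * (N + 1 / q) := by positivity

/-- The balance equations propagate the value at T along the chain: each slot carries p times it and
W carries p/q times it. The normalisation then fixes the value at T. The balance equation of W is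
redundant for uniqueness and is only checked in the converse. -/
theorem isSteadyState_iff (hq : 0 < q) (hp : 0 ≤ p) (x : BackoffState N → ℝ) :
    IsSteadyState (backoffMatrix N q p) x ↔ x = steadyVec N q p := by
  have hD := steady_denom_pos (N := N) hq hp
  have h1 : (Fin.last (N + 1)) ≠ 0 := Fin.last_pos.ne'
  constructor
  · rintro ⟨hx, hs⟩
    have hz := congrFun hx 0
    rw [backoffMatrix_zero_col] at hz
    have hmid : ∀ k (hk : k < N), x ⟨k + 1, by omega⟩ = p * x 0 := by
      intro k
      induction k with
      | zero =>
        intro hk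
        have := congrFun hx ⟨0 + 1, by omega⟩
        rw [backoffMatrix_mid_col N q p x 0 hk] at this
        rw [← this, if_pos rfl, mul_comm]
        rfl
      | succ k ih =>
        intro hk
        have := congrFun hx ⟨k + 1 + 1, by omega⟩
        rw [backoffMatrix_mid_col N q p x (k + 1) hk] at this
        rw [← this, if_neg (by omega), mul_one, ih (by omega)]
    have hlast : x (Fin.last (N + 1)) = p / q * x 0 := by
      field_simp
      linarith
    have hmid' : ∀ m : Fin N, x ⟨m + 1, by omega⟩ = p * x 0 := fun m => hmid m m.2
    rw [sum_backoffState, Finset.sum_congr rfl fun m _ => hmid' m, hlast] at hs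
    simp only [Finset.sum_const, Finset.card_univ, Fintype.card_fin, nsmul_eq_mul] at hs
    have h0 : x 0 = 1 / (1 + p * (N + 1 / q)) := by
      rw [eq_div_iff hD.ne']
      linear_combination hs
    funext i
    rw [steadyVec]
    by_cases hi0 : i = 0
    · simp only [hi0, if_true, h0]
    by_cases hil : i = Fin.last (N + 1)
    · rw [if_neg hi0, if_pos hil, hil, hlast, h0]; ring
    · rw [if_neg hi0, if_neg hil]
      have hv : (i : ℕ) ≠ 0 := fun h => hi0 (Fin.ext h)
      have hv' : (i : ℕ) ≠ N + 1 := fun h => hil (Fin.ext h)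
      have := hmid ((i : ℕ) - 1) (by omega)
      have hi : (⟨(i : ℕ) - 1 + 1, by omega⟩ : BackoffState N) = i := Fin.ext (by simp; omega)
      rw [hi] at this
      rw [this, h0]; ring
  · rintro rfl
    have hmid : ∀ k (hk : k < N), steadyVec N q p ⟨k + 1, by omega⟩ =
        p / (1 + p * (N + 1 / q)) := by
      intro k hk
      rw [steadyVec, if_neg (by simp [Fin.ext_iff]), if_neg (by simp [Fin.ext_iff]; omega)]
    have hz : steadyVec N q p 0 = 1 / (1 + p * (N + 1 / q)) := by simp [steadyVec]
    have hl : steadyVec N q p (Fin.last (N + 1)) = p / q / (1 + p * (N + 1 / q)) := by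
      rw [steadyVec, if_neg h1, if_pos rfl]
    constructor
    · funext i
      by_cases hi0 : i = 0
      · subst hi0
        rw [backoffMatrix_zero_col, hz, hl]
        field_simp
        ring
      by_cases hil : i = Fin.last (N + 1)
      · subst hil
        rw [backoffMatrix_last_col, hl]
        by_cases hN : N = 0
        · subst hN
          rw [if_pos rfl]
          have : steadyVec 0 q p ⟨0, by omega⟩ = steadyVec 0 q p 0 := rfl
          rw [this, hz]
          field_simp
          ring
        · rw [if_neg hN]
          have := hmid (N - 1) (by omega)
          have hi : (⟨N - 1 + 1, by omega⟩ : BackoffState N) = ⟨N, by omega⟩ :=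
            Fin.ext (by simp; omega)
          rw [hi] at this
          rw [this]
          field_simp
          ring
      · have hv : (i : ℕ) ≠ 0 := fun h => hi0 (Fin.ext h)
        have hv' : (i : ℕ) ≠ N + 1 := fun h => hil (Fin.ext h)
        obtain ⟨k, hk⟩ : ∃ k, (i : ℕ) = k + 1 := ⟨i - 1, by omega⟩
        have hi : i = (⟨k + 1, by omega⟩ : BackoffState N) := Fin.ext hk
        rw [hi, backoffMatrix_mid_col N q p _ k (by omega), hmid k (by omega)]
        by_cases h0 : k = 0
        · subst h0
          rw [if_pos rfl]
          have : steadyVec N q p ⟨0, by omega⟩ = steadyVec N q p 0 := rfl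
          rw [this, hz]; ring
        · rw [if_neg h0]
          obtain ⟨l, rfl⟩ : ∃ l, k = l + 1 := ⟨k - 1, by omega⟩
          rw [hmid l (by omega), mul_one]
    · rw [sum_backoffState, Finset.sum_congr rfl fun (m : Fin N) _ => hmid m m.2, hz, hl]
      simp only [Finset.sum_const, Finset.card_univ, Fintype.card_fin, nsmul_eq_mul]
      field_simp
      ring

theorem steadyVec_zero : steadyVec N q p 0 = 1 / (1 + p * (N + 1 / q)) := by simp [steadyVec]

theorem steadyVec_mem_stdSimplex (hq : 0 < q) (hp : 0 ≤ p) :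
    steadyVec N q p ∈ stdSimplex ℝ (BackoffState N) := by
  refine ⟨fun i => ?_, ((isSteadyState_iff hq hp _).2 rfl).2⟩
  have := steady_denom_pos (N := N) hq hp
  rw [steadyVec]
  split_ifs <;> positivity

theorem continuousOn_steadyVec (hq : 0 < q) :
    ContinuousOn (fun p => steadyVec N q p) (Set.Ici 0) := by
  rw [continuousOn_pi]
  intro i
  unfold steadyVec
  refine ContinuousOn.div ?_ (by fun_prop) fun p hp => (steady_denom_pos hq hp).ne'
  split_ifs <;> fun_prop

end Steady

/-! ## Ratio contraction -/

/-- `F` maps `[0, 1]` to itself, is continuous and increasing there, and `F x / x` decreases. -/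
structure IsFailureCurve (F : ℝ → ℝ) : Prop where
  mem : ∀ x ∈ Set.Icc (0 : ℝ) 1, F x ∈ Set.Icc (0 : ℝ) 1
  mono : MonotoneOn F (Set.Icc 0 1)
  star : ∀ x y, 0 < x → x ≤ y → y ≤ 1 → F y * x ≤ F x * y
  cont : ContinuousOn F (Set.Icc 0 1)

/-- Relative distance of two positive numbers. -/
def relDist (x y : ℝ) : ℝ := |x - y| / min x y

theorem relDist_comm (x y : ℝ) : relDist x y = relDist y x := by
  rw [relDist, relDist, abs_sub_comm, min_comm]

theorem relDist_nonneg {x y : ℝ} (hx : 0 < x) (hy : 0 < y) : 0 ≤ relDist x y :=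
  div_nonneg (abs_nonneg _) (lt_min hx hy).le

theorem abs_sub_le_relDist {x y : ℝ} (hx : 0 < x) (hx1 : x ≤ 1) (hy : 0 < y) :
    |x - y| ≤ relDist x y := by
  rw [relDist, le_div_iff₀ (lt_min hx hy)]
  exact mul_le_of_le_one_right (abs_nonneg _) ((min_le_left _ _).trans hx1)

namespace IsFailureCurve

variable {F : ℝ → ℝ} {M : ℝ}

theorem denom_pos (hF : IsFailureCurve F) (hM : 0 ≤ M) {x : ℝ} (hx : x ∈ Set.Icc (0 : ℝ) 1) :
    0 < 1 + F x * M := by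
  have := (hF.mem x hx).1
  positivity

theorem map_mem (hF : IsFailureCurve F) (hM : 0 ≤ M) {x : ℝ} (hx : x ∈ Set.Icc (0 : ℝ) 1) :
    1 / (1 + F x * M) ∈ Set.Ioc (0 : ℝ) 1 := by
  have h := hF.denom_pos hM hx
  refine ⟨by positivity, ?_⟩
  rw [div_le_one h]
  nlinarith [mul_nonneg (hF.mem x hx).1 hM]

/-- For x ≤ y the relative distance of the images is M (F y - F x) / (1 + M F x). Since F(x)/x
decreases, F y - F x ≤ F x (y - x) / x, which leaves the factor M F x / (1 + M F x). This is at most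
M / (1 + M) because F x ≤ 1. -/
theorem relDist_map_le (hF : IsFailureCurve F) (hM : 0 ≤ M) {x y : ℝ}
    (hx : x ∈ Set.Ioc (0 : ℝ) 1) (hy : y ∈ Set.Ioc (0 : ℝ) 1) :
    relDist (1 / (1 + F x * M)) (1 / (1 + F y * M)) ≤ M / (1 + M) * relDist x y := by
  wlog hxy : x ≤ y generalizing x y
  · rw [relDist_comm, relDist_comm x y]
    exact this hy hx (le_of_not_ge hxy)
  have hx' : x ∈ Set.Icc (0 : ℝ) 1 := ⟨hx.1.le, hx.2⟩
  have hy' : y ∈ Set.Icc (0 : ℝ) 1 := ⟨hy.1.le, hy.2⟩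
  have hm := hF.mono hx' hy' hxy
  have hs := hF.star x y hx.1 hxy hy.2
  have hFx := hF.mem x hx'
  have hdx := hF.denom_pos hM hx'
  have hdy := hF.denom_pos hM hy'
  have hle : 1 / (1 + F y * M) ≤ 1 / (1 + F x * M) :=
    one_div_le_one_div_of_le hdx (by nlinarith)
  rw [relDist, relDist, min_eq_right hle, min_eq_left hxy, abs_of_nonneg (sub_nonneg.2 hle),
    abs_of_nonpos (sub_nonpos.2 hxy)]
  have e : (1 / (1 + F x * M) - 1 / (1 + F y * M)) / (1 / (1 + F y * M)) =
      M * (F y - F x) / (1 + F x * M) := by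
    rw [show M * (F y - F x) = (1 + F y * M) - (1 + F x * M) by ring]
    generalize 1 + F x * M = a at hdx
    generalize 1 + F y * M = b at hdy
    field_simp
  rw [e, div_mul_div_comm, div_le_div_iff₀ hdx (by have := hx.1; positivity)]
  have h1 : (F y - F x) * x ≤ F x * (y - x) := by nlinarith
  have h2 : F x * (1 + M) ≤ 1 + F x * M := by nlinarith [hFx.2]
  calc M * (F y - F x) * ((1 + M) * x) = M * (1 + M) * ((F y - F x) * x) := by ring
    _ ≤ M * (1 + M) * (F x * (y - x)) := by gcongr
    _ = M * (y - x) * (F x * (1 + M)) := by ring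
    _ ≤ M * (y - x) * (1 + F x * M) := by
        have : 0 ≤ y - x := sub_nonneg.2 hxy
        gcongr
    _ = M * (-(x - y)) * (1 + F x * M) := by ring

/-- The map takes values in (0, 1], so its difference with the identity is positive at 0 and
nonpositive at 1. -/
theorem exists_fixedPoint (hF : IsFailureCurve F) (hM : 0 ≤ M) :
    ∃ x ∈ Set.Ioc (0 : ℝ) 1, x = 1 / (1 + F x * M) := by
  have hc : ContinuousOn (fun x => 1 / (1 + F x * M) - x) (Set.Icc 0 1) := by
    refine ContinuousOn.sub (ContinuousOn.div continuousOn_const ?_ fun x hx =>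
      (hF.denom_pos hM hx).ne') continuousOn_id
    exact continuousOn_const.add (hF.cont.mul continuousOn_const)
  have h := intermediate_value_Icc' zero_le_one hc
  obtain ⟨x, hx, h0⟩ := h (show (0 : ℝ) ∈ _ from
    ⟨by linarith [(hF.map_mem hM (x := 1) (by simp)).2],
     by linarith [(hF.map_mem hM (x := 0) (by simp)).1]⟩)
  have hx2 : x = 1 / (1 + F x * M) := by simp only at h0; linarith
  refine ⟨x, ?_, hx2⟩
  rw [hx2]
  exact hF.map_mem hM hx

theorem fixedPoint_unique (hF : IsFailureCurve F) (hM : 0 ≤ M) {x y : ℝ}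
    (hx : x ∈ Set.Ioc (0 : ℝ) 1) (hy : y ∈ Set.Ioc (0 : ℝ) 1)
    (hfx : x = 1 / (1 + F x * M)) (hfy : y = 1 / (1 + F y * M)) : x = y := by
  have h := hF.relDist_map_le hM hx hy
  rw [← hfx, ← hfy] at h
  have hκ : M / (1 + M) < 1 := (div_lt_one (by positivity)).2 (by linarith)
  have h0 := relDist_nonneg hx.1 hy.1
  have h1 : relDist x y ≤ 0 := by nlinarith
  have := (abs_sub_le_relDist hx.1 hx.2 hy.1).trans h1
  exact sub_eq_zero.1 (abs_nonpos_iff.1 this)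

/-- Geometric decay of the relative distance, which dominates |x - y| on (0, 1]. The start may be 0,
where the relative distance is meaningless, so the estimate begins with the first iterate. -/
theorem tendsto_iterate (hF : IsFailureCurve F) (hM : 0 ≤ M) {x : ℝ}
    (hx : x ∈ Set.Ioc (0 : ℝ) 1) (hfx : x = 1 / (1 + F x * M)) {t : ℕ → ℝ}
    (h0 : t 0 ∈ Set.Icc (0 : ℝ) 1) (ht : ∀ n, t (n + 1) = 1 / (1 + F (t n) * M)) :
    Tendsto t atTop (𝓝 x) := by
  have hmem : ∀ n, t (n + 1) ∈ Set.Ioc (0 : ℝ) 1 := by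
    intro n
    induction n with
    | zero => rw [ht]; exact hF.map_mem hM h0
    | succ n ih => rw [ht]; exact hF.map_mem hM ⟨ih.1.le, ih.2⟩
  have hb : ∀ n, relDist (t (n + 1)) x ≤ (M / (1 + M)) ^ n * relDist (t 1) x := by
    intro n
    induction n with
    | zero => simp
    | succ n ih =>
      have h := hF.relDist_map_le hM (hmem n) hx
      rw [← hfx, ← ht] at h
      refine h.trans ?_
      rw [pow_succ', mul_assoc]
      gcongr
  have hκ : M / (1 + M) < 1 := (div_lt_one (by positivity)).2 (by linarith)
  have hlim : Tendsto (fun n => (M / (1 + M)) ^ n * relDist (t 1) x) atTop (𝓝 0) := by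
    simpa using (tendsto_pow_atTop_nhds_zero_of_lt_one (by positivity) hκ).mul_const
      (relDist (t 1) x)
  rw [← tendsto_add_atTop_iff_nat 1, tendsto_iff_dist_tendsto_zero]
  refine squeeze_zero (fun _ => dist_nonneg) (fun n => ?_) hlim
  rw [Real.dist_eq]
  exact (abs_sub_le_relDist (hmem n).1 (hmem n).2 hx.1).trans (hb n)

end IsFailureCurve

/-! ## The closed form is a failure curve -/

theorem gaussHypergeometric_nonneg {a b c z : ℝ} (hb : 0 < b) (hbc : b < c) (hz : z ≤ 1) :
    0 ≤ gaussHypergeometric a b c z := by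
  have h1 := Real.Gamma_pos_of_pos hb
  have h2 := Real.Gamma_pos_of_pos (hb.trans hbc)
  have h3 := Real.Gamma_pos_of_pos (sub_pos.2 hbc)
  refine mul_nonneg (by positivity) (setIntegral_nonneg measurableSet_Ioo fun t ht => ?_)
  have h4 : 0 ≤ 1 - t := by linarith [ht.2]
  have h5 : 0 ≤ 1 - z * t := by nlinarith [ht.1, ht.2]
  have h6 := ht.1
  positivity

/-- The exponent in the closed form. -/
def outageExponent (prm : Parameters) (x : ℝ) : ℝ :=
  prm.noise * prm.theta / prm.rho +
    2 * prm.theta * prm.devInt / ((prm.eta - 2) * prm.lam) *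
      gaussHypergeometric 1 (1 - 2 / prm.eta) (2 - 2 / prm.eta) (-prm.theta) * x +
    cellConst * Real.log
      (1 + prm.theta * prm.devInt / (cellConst * prm.lam * (1 + prm.theta)) * x)

theorem cellConst_pos : 0 < cellConst := by norm_num [cellConst]

section Curve

variable {prm : Parameters}

theorem exponent_coeff_nonneg (hlam : 0 < prm.lam) (hdev : 0 < prm.devInt)
    (htheta : 0 < prm.theta) (heta : 2 < prm.eta) :
    0 ≤ 2 * prm.theta * prm.devInt / ((prm.eta - 2) * prm.lam) *
      gaussHypergeometric 1 (1 - 2 / prm.eta) (2 - 2 / prm.eta) (-prm.theta) := by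
  have h1 : 2 / prm.eta < 1 := (div_lt_one (by linarith)).2 heta
  have h2 : 0 < prm.eta - 2 := by linarith
  have := gaussHypergeometric_nonneg (a := 1) (b := 1 - 2 / prm.eta) (c := 2 - 2 / prm.eta)
    (z := -prm.theta) (by linarith) (by linarith) (by linarith)
  positivity

/-- Writes the base of the power as the inverse of an affine function of x, so that the power
becomes exp of -c times a logarithm, and the concavity in x is visible. -/
theorem closedForm_base_eq (hlam : 0 < prm.lam) (hdev : 0 < prm.devInt)
    (htheta : 0 < prm.theta) {x : ℝ} (hx : 0 ≤ x) :
    cellConst * prm.lam / (cellConst * prm.lam + x * prm.devInt) * (1 + prm.theta) /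
        (cellConst * prm.lam / (cellConst * prm.lam + x * prm.devInt) + prm.theta) =
      (1 + prm.theta * prm.devInt / (cellConst * prm.lam * (1 + prm.theta)) * x)⁻¹ := by
  have hc := cellConst_pos
  field_simp
  ring

theorem closedForm_eq_exp (hlam : 0 < prm.lam) (hdev : 0 < prm.devInt)
    (htheta : 0 < prm.theta) {x : ℝ} (hx : 0 ≤ x) :
    closedForm prm x = 1 - Real.exp (-outageExponent prm x) := by
  have hc := cellConst_pos
  have hpos : 0 < 1 + prm.theta * prm.devInt / (cellConst * prm.lam * (1 + prm.theta)) * x := by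
    positivity
  simp only [closedForm]
  rw [closedForm_base_eq hlam hdev htheta hx, Real.rpow_def_of_pos (inv_pos.2 hpos), Real.log_inv,
    ← Real.exp_add, outageExponent]
  congr 2
  ring

theorem exponent_arg_pos (hlam : 0 < prm.lam) (hdev : 0 < prm.devInt)
    (htheta : 0 < prm.theta) {x : ℝ} (hx : 0 ≤ x) :
    1 ≤ 1 + prm.theta * prm.devInt / (cellConst * prm.lam * (1 + prm.theta)) * x := by
  have hc := cellConst_pos
  have : 0 ≤ prm.theta * prm.devInt / (cellConst * prm.lam * (1 + prm.theta)) * x := by positivity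
  linarith

/-- The exponent is a nonnegative constant plus a linear term plus the logarithm of an affine
function: it is increasing, concave and nonnegative at 0. Composing with s ↦ 1 - exp(-s), which is
increasing, concave and zero at 0, gives F(t y) ≥ t F(y) for t in [0, 1]; this is the decrease of
F(x)/x. -/
theorem isFailureCurve_closedForm (hlam : 0 < prm.lam) (hdev : 0 < prm.devInt)
    (hrho : 0 < prm.rho) (htheta : 0 < prm.theta) (hnoise : 0 ≤ prm.noise) (heta : 2 < prm.eta) :
    IsFailureCurve (closedForm prm) := by
  have hc := cellConst_pos
  have hb := exponent_coeff_nonneg hlam hdev htheta heta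
  have ha : 0 ≤ prm.noise * prm.theta / prm.rho := by positivity
  have hk : 0 < prm.theta * prm.devInt / (cellConst * prm.lam * (1 + prm.theta)) := by positivity
  have harg := fun {x : ℝ} (hx : 0 ≤ x) => exponent_arg_pos hlam hdev htheta hx
  have hmono : MonotoneOn (outageExponent prm) (Set.Ici 0) := by
    intro x hx y hy hxy
    simp only [outageExponent]
    have h1 := harg hx
    have : 0 < 1 + prm.theta * prm.devInt / (cellConst * prm.lam * (1 + prm.theta)) * x := by
      linarith
    gcongr
  have hnonneg : ∀ x, 0 ≤ x → 0 ≤ outageExponent prm x := fun x hx => by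
    have := Real.log_nonneg (harg hx)
    rw [outageExponent]
    positivity
  have heq := fun {x : ℝ} (hx : 0 ≤ x) => closedForm_eq_exp hlam hdev htheta hx
  refine ⟨fun x hx => ?_, fun x hx y hy hxy => ?_, fun x y hx hxy hy => ?_, ?_⟩
  · rw [heq hx.1]
    have h1 := Real.exp_pos (-outageExponent prm x)
    have h2 := Real.exp_le_one_iff.2 (neg_nonpos.2 (hnonneg x hx.1))
    constructor <;> linarith
  · rw [heq hx.1, heq hy.1]
    have := hmono hx.1 hy.1 hxy
    gcongr
  · have hy0 : 0 < y := hx.trans_le hxy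
    rw [heq hx.le, heq hy0.le]
    obtain ⟨t, ht, ht0, ht1⟩ : ∃ t, x = t * y ∧ 0 ≤ t ∧ t ≤ 1 :=
      ⟨x / y, by field_simp, by positivity, (div_le_one hy0).2 hxy⟩
    -- Concavity of log between the arguments belonging to 0 and to y.
    have hlog := strictConcaveOn_log_Ioi.concaveOn.2 (x := 1) (by simp : (1 : ℝ) ∈ Set.Ioi 0)
      (lt_of_lt_of_le one_pos (harg hy0.le)) (sub_nonneg.2 ht1) ht0 (by ring)
    simp only [smul_eq_mul, Real.log_one, mul_zero, zero_add] at hlog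
    have hphi : t * outageExponent prm y ≤ outageExponent prm x := by
      simp only [outageExponent]
      have e : (1 - t) * 1 + t * (1 + prm.theta * prm.devInt /
          (cellConst * prm.lam * (1 + prm.theta)) * y) =
          1 + prm.theta * prm.devInt / (cellConst * prm.lam * (1 + prm.theta)) * x := by
        rw [ht]; ring
      rw [e] at hlog
      have h1 := mul_le_mul_of_nonneg_left hlog hc.le
      have h2 := mul_le_mul_of_nonneg_right ht1 ha
      have h3 : 2 * prm.theta * prm.devInt / ((prm.eta - 2) * prm.lam) *
          gaussHypergeometric 1 (1 - 2 / prm.eta) (2 - 2 / prm.eta) (-prm.theta) * x =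
          t * (2 * prm.theta * prm.devInt / ((prm.eta - 2) * prm.lam) *
          gaussHypergeometric 1 (1 - 2 / prm.eta) (2 - 2 / prm.eta) (-prm.theta) * y) := by
        rw [ht]; ring
      rw [h3]
      linarith
    -- Convexity of exp between 0 and -φ(y): exp(-t φ(y)) ≤ 1 - t + t exp(-φ(y)).
    have hexp := convexOn_exp.2 (Set.mem_univ 0) (Set.mem_univ (-outageExponent prm y))
      (sub_nonneg.2 ht1) ht0 (by ring)
    simp only [smul_eq_mul, mul_zero, zero_add, Real.exp_zero, mul_one] at hexp
    have h4 : Real.exp (-outageExponent prm x) ≤ Real.exp (t * -outageExponent prm y) :=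
      Real.exp_le_exp.2 (by linarith)
    have h5 : t * (1 - Real.exp (-outageExponent prm y)) ≤
        1 - Real.exp (-outageExponent prm x) := by linarith
    have h6 := mul_le_mul_of_nonneg_right h5 hy0.le
    rw [ht]
    rw [ht] at h6
    linarith
  · refine ContinuousOn.congr (f := fun x => 1 - Real.exp (-outageExponent prm x)) ?_
      fun x hx => heq hx.1
    refine continuousOn_const.sub (ContinuousOn.rexp (ContinuousOn.neg ?_))
    unfold outageExponent
    refine ContinuousOn.add (by fun_prop) (continuousOn_const.mul (ContinuousOn.log (by fun_prop)
      fun x hx => ?_))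
    linarith [harg hx.1]

end Curve

/-! ## The self-consistent state vector and the algorithm -/

/-- The part of the theorem that concerns the closed form alone. -/
theorem exists_selfConsistent {prm : Parameters} (hF : IsFailureCurve (closedForm prm))
    (hq : 0 < prm.q) :
    ∃ xStar ∈ stdSimplex ℝ (BackoffState prm.N),
      IsSteadyState (backoffMatrix prm.N prm.q (closedForm prm (xStar 0))) xStar ∧
      (∀ y ∈ stdSimplex ℝ (BackoffState prm.N),
        IsSteadyState (backoffMatrix prm.N prm.q (closedForm prm (y 0))) y → y = xStar) ∧
      ∀ xInit ∈ stdSimplex ℝ (BackoffState prm.N),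
        (∃! xs, IsIterates prm xInit xs) ∧
        (∀ xs, IsIterates prm xInit xs → Tendsto xs atTop (𝓝 xStar)) ∧
        (∀ ε > 0, ∃! y, AlgorithmReturns prm ε xInit y) ∧
        ∀ δ > 0, ∃ ε₀ > 0, ∀ ε, 0 < ε → ε < ε₀ →
          ∀ y, AlgorithmReturns prm ε xInit y → ‖y - xStar‖ < δ := by
  have hM : (0 : ℝ) ≤ prm.N + 1 / prm.q := by positivity
  have h01 : ∀ y ∈ stdSimplex ℝ (BackoffState prm.N), y 0 ∈ Set.Icc (0 : ℝ) 1 := fun y hy =>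
    ⟨hy.1 0, hy.2 ▸ Finset.single_le_sum (fun i _ => hy.1 i) (Finset.mem_univ 0)⟩
  set S : ℝ → BackoffState prm.N → ℝ := fun t => steadyVec prm.N prm.q (closedForm prm t) with hS
  have hiff : ∀ t ∈ Set.Icc (0 : ℝ) 1, ∀ y,
      IsSteadyState (backoffMatrix prm.N prm.q (closedForm prm t)) y ↔ y = S t :=
    fun t ht y => isSteadyState_iff hq (hF.mem t ht).1 y
  have hSmem : ∀ t ∈ Set.Icc (0 : ℝ) 1, S t ∈ stdSimplex ℝ (BackoffState prm.N) := fun t ht =>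
    steadyVec_mem_stdSimplex hq (hF.mem t ht).1
  have hS0 : ∀ t, S t 0 = 1 / (1 + closedForm prm t * (prm.N + 1 / prm.q)) := fun t =>
    steadyVec_zero
  have hScont : ContinuousOn S (Set.Icc 0 1) :=
    (continuousOn_steadyVec hq).comp hF.cont fun t ht => (hF.mem t ht).1
  obtain ⟨x, hx, hfx⟩ := hF.exists_fixedPoint hM
  have hx' : x ∈ Set.Icc (0 : ℝ) 1 := ⟨hx.1.le, hx.2⟩
  have hSx : S x 0 = x := by rw [hS0, ← hfx]
  have huniq : ∀ y ∈ stdSimplex ℝ (BackoffState prm.N),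
      IsSteadyState (backoffMatrix prm.N prm.q (closedForm prm (y 0))) y → y = S x := by
    intro y hy hst
    have h1 := (hiff _ (h01 y hy) y).1 hst
    have h2 : y 0 = 1 / (1 + closedForm prm (y 0) * (prm.N + 1 / prm.q)) := by
      rw [← hS0, ← h1]
    have h3 : y 0 ∈ Set.Ioc (0 : ℝ) 1 := by rw [h2]; exact hF.map_mem hM (h01 y hy)
    rw [h1, hF.fixedPoint_unique hM h3 hx h2 hfx]
  refine ⟨S x, hSmem x hx', ?_, huniq, fun xInit hInit => ?_⟩
  · rw [hiff _ (by rwa [hSx]), hSx]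
  have hmem : ∀ xs, IsIterates prm xInit xs → ∀ i, xs i ∈ stdSimplex ℝ (BackoffState prm.N) := by
    intro xs h i
    induction i with
    | zero => rw [h.1]; exact hInit
    | succ i ih => rw [(hiff _ (h01 _ ih) _).1 (h.2 i)]; exact hSmem _ (h01 _ ih)
  have hstep : ∀ xs, IsIterates prm xInit xs → ∀ i, xs (i + 1) = S (xs i 0) := fun xs h i =>
    (hiff _ (h01 _ (hmem xs h i)) _).1 (h.2 i)
  have hunique : ∀ xs ys, IsIterates prm xInit xs → IsIterates prm xInit ys → xs = ys := by
    intro xs ys h1 h2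
    funext i
    induction i with
    | zero => rw [h1.1, h2.1]
    | succ i ih => rw [hstep xs h1, hstep ys h2, ih]
  let zs : ℕ → BackoffState prm.N → ℝ := fun n => Nat.rec xInit (fun _ y => S (y 0)) n
  have hzmem : ∀ i, zs i ∈ stdSimplex ℝ (BackoffState prm.N) := by
    intro i
    induction i with
    | zero => exact hInit
    | succ i ih => exact hSmem _ (h01 _ ih)
  have hzs : IsIterates prm xInit zs := ⟨rfl, fun i => (hiff _ (h01 _ (hzmem i)) _).2 rfl⟩
  have hlim : Tendsto zs atTop (𝓝 (S x)) := by
    have h1 : Tendsto (fun i => zs i 0) atTop (𝓝 x) :=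
      hF.tendsto_iterate hM hx hfx (h01 _ (hzmem 0)) fun n => hS0 _
    have h2 : Tendsto (fun i => zs i 0) atTop (𝓝[Set.Icc 0 1] x) :=
      tendsto_nhdsWithin_iff.2 ⟨h1, Eventually.of_forall fun i => h01 _ (hzmem i)⟩
    -- The whole vector is a continuous function of the previous entry at T, so scalar convergence
    -- suffices.
    exact (tendsto_add_atTop_iff_nat 1).1 ((hScont x hx').tendsto.comp h2)
  have hdiff : Tendsto (fun i => ‖zs (i + 1) - zs i‖) atTop (𝓝 0) := by
    simpa using (((tendsto_add_atTop_iff_nat 1).2 hlim).sub hlim).norm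
  refine ⟨⟨zs, hzs, fun ys h => hunique _ _ h hzs⟩,
    fun xs h => by rw [hunique xs zs h hzs]; exact hlim, fun ε hε => ?_, fun δ hδ => ?_⟩
  · classical
    have hex : ∃ i, ‖zs (i + 1) - zs i‖ < ε := (hdiff.eventually (gt_mem_nhds hε)).exists
    refine ⟨zs (Nat.find hex + 1), ⟨zs, hzs, Nat.find hex, Nat.find_spec hex,
      fun j hj => not_lt.1 (Nat.find_min hex hj), rfl⟩, ?_⟩
    rintro y ⟨xs, hxs, i, hi, hmin, rfl⟩
    obtain rfl := hunique xs zs hxs hzs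
    have : Nat.find hex = i :=
      (Nat.find_eq_iff hex).2 ⟨hi, fun j hj => not_lt.2 (hmin j hj)⟩
    rw [this]
  · obtain ⟨n, hn⟩ := eventually_atTop.1
      (hlim.eventually (Metric.ball_mem_nhds (S x) hδ))
    -- From index n on, the iterates are within δ of the limit. Below the smallest nonzero step
    -- among the first n, a tolerance can stop the loop early only at a step of length zero.
    obtain ⟨ε₀, hε₀, hlt⟩ : ∃ ε₀ > 0, ∀ i < n, 0 < ‖zs (i + 1) - zs i‖ →
        ε₀ ≤ ‖zs (i + 1) - zs i‖ := by
      clear hn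
      induction n with
      | zero => exact ⟨1, one_pos, by simp⟩
      | succ n ih =>
        obtain ⟨e, he, h⟩ := ih
        by_cases h0 : 0 < ‖zs (n + 1) - zs n‖
        · refine ⟨min e ‖zs (n + 1) - zs n‖, lt_min he h0, fun i hi hp => ?_⟩
          rcases Nat.lt_succ_iff_lt_or_eq.1 hi with hi | rfl
          · exact (min_le_left _ _).trans (h i hi hp)
          · exact min_le_right _ _
        · refine ⟨e, he, fun i hi hp => ?_⟩
          rcases Nat.lt_succ_iff_lt_or_eq.1 hi with hi | rfl
          · exact h i hi hp
          · exact absurd hp h0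
    refine ⟨ε₀, hε₀, fun ε hε hεlt y ⟨xs, hxs, i, hi, hmin, hy⟩ => ?_⟩
    obtain rfl := hunique xs zs hxs hzs
    subst hy
    by_cases hin : i < n
    · have h0 : ‖zs (i + 1) - zs i‖ = 0 := by
        by_contra hne
        exact absurd (hlt i hin ((norm_nonneg _).lt_of_ne' hne)) (not_le.2 (hi.trans hεlt))
      -- A zero step means the iterate is already self-consistent, hence equal to the limit.
      have h1 : zs (i + 1) = zs i := sub_eq_zero.1 (norm_eq_zero.1 h0)
      have h2 : zs (i + 1) = S x := huniq _ (hzmem (i + 1)) (by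
        have := hzs.2 i
        rwa [← h1] at this)
      rw [h2, sub_self, norm_zero]
      exact hδ
    · rw [← dist_eq_norm]
      exact hn (i + 1) (by omega)

/-! ## The decreasing exponential on `[0, ∞]` -/

/-- `exp (-x)` for `x ∈ [0, ∞]`. -/
def expNeg (x : ENNReal) : ENNReal := EReal.exp (-(x : EReal))

theorem expNeg_eq_inv (x : ENNReal) : expNeg x = (EReal.exp x)⁻¹ := EReal.exp_neg _

theorem expNeg_ofReal {a : ℝ} (ha : 0 ≤ a) :
    expNeg (ENNReal.ofReal a) = ENNReal.ofReal (Real.exp (-a)) := by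
  rw [expNeg, EReal.coe_ennreal_ofReal, max_eq_left ha, ← EReal.coe_neg, EReal.exp_coe]

theorem expNeg_zero : expNeg 0 = 1 := by simp [expNeg]

theorem expNeg_top : expNeg ⊤ = 0 := by simp [expNeg]

theorem continuous_expNeg : Continuous expNeg :=
  ENNReal.continuous_exp.comp (continuous_neg.comp continuous_coe_ennreal_ereal)

theorem measurable_expNeg : Measurable expNeg := continuous_expNeg.measurable

theorem antitone_expNeg : Antitone expNeg := fun _ _ h =>
  EReal.exp_monotone (EReal.neg_le_neg_iff.2 (EReal.coe_ennreal_le_coe_ennreal_iff.2 h))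

theorem expNeg_le_one (x : ENNReal) : expNeg x ≤ 1 := by
  rw [← expNeg_zero]
  exact antitone_expNeg zero_le

theorem expNeg_ne_top (x : ENNReal) : expNeg x ≠ ⊤ :=
  ((expNeg_le_one x).trans_lt ENNReal.one_lt_top).ne

theorem expNeg_add (x y : ENNReal) : expNeg (x + y) = expNeg x * expNeg y := by
  have h : ∀ z : ENNReal, EReal.exp (z : EReal) ≠ 0 := fun z h => by
    have h1 := expNeg_ne_top z
    rw [expNeg_eq_inv, h, ENNReal.inv_zero] at h1
    exact h1 rfl
  rw [expNeg_eq_inv, expNeg_eq_inv, expNeg_eq_inv, EReal.coe_ennreal_add, EReal.exp_add,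
    ENNReal.mul_inv (Or.inl (h x)) (Or.inr (h y))]

theorem expNeg_sum {ι : Type*} (s : Finset ι) (f : ι → ENNReal) :
    expNeg (∑ i ∈ s, f i) = ∏ i ∈ s, expNeg (f i) := by
  classical
  induction s using Finset.induction_on with
  | empty => simp [expNeg_zero]
  | insert a s ha ih => rw [Finset.sum_insert ha, Finset.prod_insert ha, expNeg_add, ih]

theorem expNeg_mul_natCast (a : ENNReal) (n : ℕ) : expNeg (a * n) = expNeg a ^ n := by
  have := expNeg_sum (Finset.range n) fun _ => a
  simpa [mul_comm] using this

/-! ## Integrals of functions of a discrete random variable -/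

/-- The prescribed weights already sum to 1, so the listed values are almost surely the only ones.
For a point count this rules out the value ∞, which the Poisson law does not mention. -/
theorem lintegral_comp_eq_tsum {Ω β : Type*} [MeasurableSpace Ω] [MeasurableSpace β]
    [MeasurableSingletonClass β] {μ : Measure Ω} [IsProbabilityMeasure μ] {X : Ω → β}
    (hX : Measurable X) {v : ℕ → β} (hv : Function.Injective v) {w : ℕ → ENNReal}
    (hw : ∑' n, w n = 1) (h : ∀ n, μ {ω | X ω = v n} = w n) (g : β → ENNReal) :
    ∫⁻ ω, g (X ω) ∂μ = ∑' n, g (v n) * w n := by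
  have hm : ∀ n, MeasurableSet {ω | X ω = v n} := fun n => hX (measurableSet_singleton _)
  have hd : Pairwise fun m n => Disjoint {ω | X ω = v m} {ω | X ω = v n} := by
    intro m n hmn
    rw [Set.disjoint_left]
    intro ω h1 h2
    exact hmn (hv (h1.symm.trans h2))
  have hU : (⋃ n, {ω | X ω = v n}) =ᵐ[μ] Set.univ := by
    rw [ae_eq_univ, prob_compl_eq_zero_iff (MeasurableSet.iUnion hm), measure_iUnion hd hm]
    simp only [h, hw]
  rw [← setLIntegral_univ, ← setLIntegral_congr hU, lintegral_iUnion hm hd]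
  congr 1
  funext n
  rw [setLIntegral_congr_fun (g := fun _ => g (v n)) (hm n) fun ω hω => by
    have hω : X ω = v n := hω
    simp only [hω], setLIntegral_const, h]

theorem tsum_poissonMeasure (m : NNReal) : ∑' n, poissonMeasure m {n} = 1 := by
  have := measure_iUnion (μ := poissonMeasure m) (f := fun n : ℕ => ({n} : Set ℕ))
    (fun i j hij => by simpa using hij) fun n => measurableSet_singleton n
  rw [← this, Set.iUnion_of_singleton, measure_univ]

/-- Generating function of the Poisson distribution. -/
theorem tsum_pow_mul_poissonMeasure (m : NNReal) {z : ENNReal} (hz : z ≤ 1) :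
    ∑' n, z ^ n * poissonMeasure m {n} = expNeg (m * (1 - z)) := by
  obtain ⟨t, ht0, rfl⟩ : ∃ t : ℝ, 0 ≤ t ∧ z = ENNReal.ofReal t :=
    ⟨z.toReal, ENNReal.toReal_nonneg, (ENNReal.ofReal_toReal (hz.trans_lt ENNReal.one_lt_top).ne).symm⟩
  have ht1 : t ≤ 1 := by simpa using hz
  have hs : HasSum (fun n : ℕ => t ^ n * (Real.exp (-m) * (m : ℝ) ^ n / n.factorial))
      (Real.exp (-(m * (1 - t)))) := by
    have h := (NormedSpace.expSeries_div_hasSum_exp ((m : ℝ) * t)).mul_left (Real.exp (-m))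
    rw [← Real.exp_eq_exp_ℝ, ← Real.exp_add] at h
    convert! h using 1
    · funext n
      rw [mul_pow]; ring
    · congr 1; ring
  have h1 : ∀ n : ℕ, ENNReal.ofReal t ^ n * poissonMeasure m {n} =
      ENNReal.ofReal (t ^ n * (Real.exp (-m) * (m : ℝ) ^ n / n.factorial)) := fun n => by
    rw [poissonMeasure_singleton, ← ENNReal.ofReal_pow ht0, ← ENNReal.ofReal_mul (by positivity)]
  simp only [h1]
  rw [← ENNReal.ofReal_tsum_of_nonneg (fun n => by positivity) hs.summable, hs.tsum_eq,
    ← expNeg_ofReal (mul_nonneg m.coe_nonneg (sub_nonneg.2 ht1)), ENNReal.ofReal_mul m.coe_nonneg,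
    ENNReal.ofReal_sub _ ht0, ENNReal.ofReal_one]
  simp

/-! ## The Laplace functional of a Poisson process -/

section Laplace

variable {Ω : Type*} [MeasurableSpace Ω] {μ : Measure Ω}
  {u : ℕ → Ω → Plane} {r : ℝ}

theorem IsPoissonProcess.measurable_pointCount (h : IsPoissonProcess μ u r) {B : Set Plane}
    (hB : MeasurableSet B) : Measurable (pointCount u B) :=
  Measurable.tsum fun i => (measurable_const.indicator hB).comp (h.measurable i)

variable [IsProbabilityMeasure μ]

theorem IsPoissonProcess.lintegral_expNeg_pointCount (h : IsPoissonProcess μ u r)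
    {B : Set Plane} (hB : MeasurableSet B) (hv : volume B < ⊤) (a : ENNReal) :
    ∫⁻ ω, expNeg (a * pointCount u B ω) ∂μ =
      expNeg (ENNReal.ofReal r * ((1 - expNeg a) * volume B)) := by
  have hm : ((r * (volume B).toReal).toNNReal : ENNReal) = ENNReal.ofReal r * volume B := by
    change ENNReal.ofReal _ = _
    rw [ENNReal.ofReal_mul' ENNReal.toReal_nonneg, ENNReal.ofReal_toReal hv.ne]
  rw [lintegral_comp_eq_tsum (h.measurable_pointCount hB) (v := fun n : ℕ => (n : ENNReal))
    Nat.cast_injective (tsum_poissonMeasure _) (h.count_law B hB hv) fun t => expNeg (a * t)]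
  simp only [expNeg_mul_natCast]
  rw [tsum_pow_mul_poissonMeasure _ (expNeg_le_one a), hm]
  congr 1
  ring

/-- Counts of disjoint sets are independent, so the transform is a product of Poisson generating
functions at exp(-a j); a j = ∞ is allowed. -/
theorem IsPoissonProcess.lintegral_expNeg_sum (h : IsPoissonProcess μ u r)
    {ι : Type*} [Fintype ι] {B : ι → Set Plane} (hB : ∀ j, MeasurableSet (B j))
    (hd : Pairwise fun j k => Disjoint (B j) (B k)) (hv : ∀ j, volume (B j) < ⊤)
    (a : ι → ENNReal) :
    ∫⁻ ω, expNeg (∑ j, a j * pointCount u (B j) ω) ∂μ =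
      expNeg (ENNReal.ofReal r * ∑ j, (1 - expNeg (a j)) * volume (B j)) := by
  let e := (Fintype.equivFin ι)
  have hi : iIndepFun (fun j => pointCount u (B j)) μ := by
    have := h.count_indep _ (fun j => B (e.symm j)) (fun j => hB _)
      fun j k hjk => hd (e.symm.injective.ne hjk)
    have := this.precomp e.injective
    simpa using this
  have hi2 := hi.comp (fun j t => expNeg (a j * t)) fun j =>
    measurable_expNeg.comp (measurable_const.mul measurable_id)
  simp only [expNeg_sum, Finset.mul_sum]
  refine (lintegral_prod_eq_prod_lintegral_of_indepFun Finset.univ _ hi2 fun j =>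
    measurable_expNeg.comp (measurable_const.mul (h.measurable_pointCount (hB j)))).trans ?_
  exact Finset.prod_congr rfl fun j _ => h.lintegral_expNeg_pointCount (hB j) (hv j) (a j)

theorem SimpleFunc.indicator_comp_eq_sum {α : Type*} [MeasurableSpace α]
    (f : SimpleFunc α ENNReal) (B : Set α) (g : ENNReal → ENNReal) (x : α) :
    B.indicator (fun x => g (f x)) x =
      ∑ y : f.range, g y * (f ⁻¹' {(y : ENNReal)} ∩ B).indicator (fun _ => 1) x := by
  rw [Finset.sum_eq_single (⟨f x, f.mem_range_self x⟩ : f.range)]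
  · by_cases hx : x ∈ B <;> simp [hx]
  · intro y _ hy
    rw [Set.indicator_of_notMem, mul_zero]
    rintro ⟨h, -⟩
    exact hy (Subtype.ext h.symm)
  · simp

/-- The Laplace functional for simple functions restricted to a bounded set. -/
theorem IsPoissonProcess.lintegral_expNeg_simpleFunc (h : IsPoissonProcess μ u r)
    (f : SimpleFunc Plane ENNReal) {B : Set Plane} (hB : MeasurableSet B) (hv : volume B < ⊤) :
    ∫⁻ ω, expNeg (∑' i, B.indicator f (u i ω)) ∂μ =
      expNeg (ENNReal.ofReal r * ∫⁻ x, 1 - expNeg (B.indicator f x)) := by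
  have hm : ∀ y : ENNReal, MeasurableSet (f ⁻¹' {y} ∩ B) := fun y =>
    (f.measurableSet_fiber y).inter hB
  have h1 := h.lintegral_expNeg_sum (B := fun y : f.range => f ⁻¹' {(y : ENNReal)} ∩ B)
    (fun y => hm y) (fun y z hyz => by
      refine Set.disjoint_left.2 ?_
      rintro x ⟨h1, -⟩ ⟨h2, -⟩
      exact hyz (Subtype.ext (h1.symm.trans h2)))
    (fun y => (measure_mono Set.inter_subset_right).trans_lt hv) (fun y => (y : ENNReal))
  have h2 : ∀ ω, ∑' i, B.indicator f (u i ω) =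
      ∑ y : f.range, (y : ENNReal) * pointCount u (f ⁻¹' {(y : ENNReal)} ∩ B) ω := fun ω => by
    simp only [pointCount, ← ENNReal.tsum_mul_left]
    rw [← Summable.tsum_finsetSum fun _ _ => ENNReal.summable]
    congr 1
    funext i
    exact SimpleFunc.indicator_comp_eq_sum f B (fun y => y) (u i ω)
  have h3 : ∀ x, 1 - expNeg (B.indicator f x) = ∑ y : f.range, (1 - expNeg y) *
      (f ⁻¹' {(y : ENNReal)} ∩ B).indicator (fun _ => 1) x := fun x => by
    rw [← SimpleFunc.indicator_comp_eq_sum f B (fun y => 1 - expNeg y) x]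
    by_cases hx : x ∈ B <;> simp [hx, expNeg_zero]
  simp only [h2, h3, h1]
  have h4 := lintegral_finsetSum (μ := volume) (Finset.univ : Finset f.range)
    (f := fun y x => (1 - expNeg y) * (f ⁻¹' {(y : ENNReal)} ∩ B).indicator (fun _ => 1) x)
    fun y _ => measurable_const.mul (measurable_const.indicator (hm y))
  rw [h4]
  congr 3
  funext y
  rw [lintegral_const_mul _ (measurable_const.indicator (hm y)), lintegral_indicator (hm y)]
  simp

/-- The Laplace functional of a homogeneous Poisson process. -/
theorem IsPoissonProcess.lintegral_expNeg_tsum (h : IsPoissonProcess μ u r)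
    {f : Plane → ENNReal} (hf : Measurable f) :
    ∫⁻ ω, expNeg (∑' i, f (u i ω)) ∂μ =
      expNeg (ENNReal.ofReal r * ∫⁻ x, 1 - expNeg (f x)) := by
  -- Simple functions increasing to f, cut off to balls because the count law is given only for sets
  -- of finite volume.
  let g : ℕ → Plane → ENNReal := fun n =>
    (Metric.ball (0 : Plane) n).indicator (SimpleFunc.eapprox f n)
  have hg : ∀ n, Measurable (g n) := fun n =>
    (SimpleFunc.measurable _).indicator measurableSet_ball
  have hmono : ∀ x, Monotone fun n => g n x := by
    intro x m n hmn
    refine (Set.indicator_le_indicator (SimpleFunc.monotone_eapprox f hmn x)).trans ?_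
    exact Set.indicator_le_indicator_of_subset
      (Metric.ball_subset_ball (by exact_mod_cast hmn)) (fun _ => zero_le) x
  have hlim : ∀ x, Tendsto (fun n => g n x) atTop (𝓝 (f x)) := by
    intro x
    have h1 : Tendsto (fun n => SimpleFunc.eapprox f n x) atTop (𝓝 (f x)) := by
      rw [← SimpleFunc.iSup_eapprox_apply hf x]
      exact tendsto_atTop_iSup fun m n hmn => SimpleFunc.monotone_eapprox f hmn x
    refine h1.congr' ?_
    obtain ⟨n, hn⟩ := exists_nat_gt ‖x‖
    filter_upwards [eventually_ge_atTop n] with k hk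
    have : x ∈ Metric.ball (0 : Plane) k := by
      rw [mem_ball_zero_iff]
      exact hn.trans_le (by exact_mod_cast hk)
    simp only [g, Set.indicator_of_mem this]
  have hs : ∀ n, ∫⁻ ω, expNeg (∑' i, g n (u i ω)) ∂μ =
      expNeg (ENNReal.ofReal r * ∫⁻ x, 1 - expNeg (g n x)) := fun n =>
    h.lintegral_expNeg_simpleFunc _ measurableSet_ball measure_ball_lt_top
  have hL : Tendsto (fun n => ∫⁻ ω, expNeg (∑' i, g n (u i ω)) ∂μ) atTop
      (𝓝 (∫⁻ ω, expNeg (∑' i, f (u i ω)) ∂μ)) := by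
    refine tendsto_lintegral_of_dominated_convergence (fun _ => 1) (fun n => ?_)
      (fun n => Eventually.of_forall fun ω => expNeg_le_one _) (by simp)
      (Eventually.of_forall fun ω => (continuous_expNeg.tendsto _).comp ?_)
    · exact measurable_expNeg.comp
        (Measurable.tsum fun i => (hg n).comp (h.measurable i))
    -- The series over the points is an integral against counting measure, so monotone convergence
    -- applies.
    · simp only [← lintegral_count]
      exact lintegral_tendsto_of_tendsto_of_monotone (fun n => (measurable_of_countable _).aemeasurable)
        (Eventually.of_forall fun i => hmono _) (Eventually.of_forall fun i => hlim _)
  have hR : Tendsto (fun n => expNeg (ENNReal.ofReal r * ∫⁻ x, 1 - expNeg (g n x))) atTop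
      (𝓝 (expNeg (ENNReal.ofReal r * ∫⁻ x, 1 - expNeg (f x)))) := by
    refine (continuous_expNeg.tendsto _).comp (ENNReal.Tendsto.const_mul ?_
      (Or.inr ENNReal.ofReal_ne_top))
    refine lintegral_tendsto_of_tendsto_of_monotone
      (fun n => (measurable_const.sub (measurable_expNeg.comp (hg n))).aemeasurable)
      (Eventually.of_forall fun x m n hmn => tsub_le_tsub_left (antitone_expNeg (hmono x hmn)) 1)
      (Eventually.of_forall fun x => ?_)
    exact ((ENNReal.continuous_sub_left ENNReal.one_ne_top).comp continuous_expNeg).tendsto _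
      |>.comp (hlim x)
  simp only [hs] at hL
  exact tendsto_nhds_unique hL hR

end Laplace

/-! ## Independent marks -/

section Marks

variable {Ω α β : Type*} [mΩ : MeasurableSpace Ω] [MeasurableSpace α] [MeasurableSpace β]
  {μ : Measure Ω}

theorem indepFun_of_indep {X : Ω → α} {m : Ω → β} {mX mm : MeasurableSpace Ω}
    (hind : Indep mX mm μ) (hX : Measurable[mX] X) (hm : Measurable[mm] m) : IndepFun X m μ :=
  (IndepFun_iff_Indep X m μ).2 (indep_of_indep_of_le_left
    (indep_of_indep_of_le_right hind hm.comap_le) hX.comap_le)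

variable [IsProbabilityMeasure μ]

/-- Two independent variables may be integrated one after the other. -/
theorem lintegral_indepFun {X : Ω → α} {m : Ω → β} (hX : Measurable X) (hm : Measurable m)
    (hind : IndepFun X m μ) {H : α × β → ENNReal} (hH : Measurable H) :
    ∫⁻ ω, H (X ω, m ω) ∂μ = ∫⁻ ω, ∫⁻ ω', H (X ω, m ω') ∂μ ∂μ := by
  have hp := (indepFun_iff_map_prod_eq_prod_map_map hX.aemeasurable hm.aemeasurable).1 hind
  rw [← lintegral_map (f := H) hH (hX.prodMk hm), hp, lintegral_prod _ hH.aemeasurable,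
    lintegral_map hH.lintegral_prod_right' hX]
  congr 1
  funext ω
  exact lintegral_map (f := fun y => H (X ω, y)) (hH.comp measurable_prodMk_left) hm

theorem measurable_lintegral_mark {m : Ω → β} (hm : Measurable m) {H : α × β → ENNReal}
    (hH : Measurable H) : Measurable fun x => ∫⁻ ω, H (x, m ω) ∂μ := by
  have : (fun x => ∫⁻ ω, H (x, m ω) ∂μ) = fun x => ∫⁻ y, H (x, y) ∂(μ.map m) := by
    funext x
    exact (lintegral_map (f := fun y => H (x, y)) (hH.comp measurable_prodMk_left) hm).symm
  rw [this]
  have := Measure.isProbabilityMeasure_map (μ := μ) hm.aemeasurable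
  exact hH.lintegral_prod_right'

/-- Each mark `m i` is independent of a σ-algebra `A i` which makes everything else measurable:
all the marks may then be integrated out of a product. -/
theorem lintegral_prod_marks {ι : Type*} {u : ι → Ω → α} {m : ι → Ω → β}
    {A B : ι → MeasurableSpace Ω} (hA : ∀ i, A i ≤ mΩ) (hB : ∀ i, B i ≤ mΩ)
    (hind : ∀ i, Indep (A i) (B i) μ) (hu : ∀ i j, Measurable[A i] (u j))
    (hm : ∀ i, Measurable[B i] (m i)) (hmA : ∀ i j, j ≠ i → Measurable[A i] (m j))
    {φ : α × β → ENNReal} (hφ : Measurable φ) {g : α → ENNReal}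
    (hg : ∀ i x, ∫⁻ ω, φ (x, m i ω) ∂μ = g x) (hgm : Measurable g) (s : Finset ι)
    {Y : Ω → ENNReal} (hY : ∀ i, Measurable[A i] Y) :
    ∫⁻ ω, (∏ i ∈ s, φ (u i ω, m i ω)) * Y ω ∂μ = ∫⁻ ω, (∏ i ∈ s, g (u i ω)) * Y ω ∂μ := by
  classical
  induction s using Finset.induction_on generalizing Y with
  | empty => simp
  | insert a s ha ih =>
    -- All factors except the one with mark a are measurable for `A a`, so that mark can be
    -- integrated alone.
    have hZ : Measurable[A a] fun ω => (∏ i ∈ s, φ (u i ω, m i ω)) * Y ω := by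
      refine Measurable.mul (Finset.measurable_prod s fun i hi => hφ.comp
        (Measurable.prodMk (hu a i) (hmA a i ?_))) (hY a)
      rintro rfl
      exact ha hi
    have h1 := lintegral_indepFun (X := fun ω => ((∏ i ∈ s, φ (u i ω, m i ω)) * Y ω, u a ω))
      ((Measurable.prodMk hZ (hu a a)).mono (hA a) le_rfl) ((hm a).mono (hB a) le_rfl)
      (indepFun_of_indep (hind a) (Measurable.prodMk hZ (hu a a)) (hm a))
      (H := fun p => p.1.1 * φ (p.1.2, p.2)) (by fun_prop)
    have h2 : ∀ ω, (∏ i ∈ insert a s, φ (u i ω, m i ω)) * Y ω =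
        (∏ i ∈ s, φ (u i ω, m i ω)) * Y ω * φ (u a ω, m a ω) := fun ω => by
      rw [Finset.prod_insert ha]; ring
    have h3 : ∀ ω, ∫⁻ ω', (∏ i ∈ s, φ (u i ω, m i ω)) * Y ω * φ (u a ω, m a ω') ∂μ =
        (∏ i ∈ s, φ (u i ω, m i ω)) * (Y ω * g (u a ω)) := fun ω => by
      refine (lintegral_const_mul _ ((hφ.comp measurable_prodMk_left).comp
        ((hm a).mono (hB a) le_rfl))).trans ?_
      rw [← mul_assoc, ← hg a]
      rfl
    -- The averaged factor no longer contains a mark, so it joins Y; this is why the induction runs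
    -- over all Y.
    have hY' : ∀ i, Measurable[A i] fun ω => Y ω * g (u a ω) := fun i =>
      Measurable.mul (hY i) (hgm.comp (hu i a))
    simp only [h2]
    rw [h1]
    simp only [h3]
    rw [ih hY']
    congr 1
    funext ω
    rw [Finset.prod_insert ha]; ring

end Marks

/-- A number in `[0, 1]` as `exp (-x)`. -/
theorem expNeg_toENNReal_neg_log {z : ENNReal} (hz : z ≤ 1) :
    expNeg (-ENNReal.log z).toENNReal = z := by
  have h : (0 : EReal) ≤ -ENNReal.log z := by
    have := EReal.neg_le_neg_iff.2 (ENNReal.log_le_zero_iff.2 hz)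
    rwa [neg_zero] at this
  rw [expNeg, EReal.coe_toENNReal h, neg_neg, ENNReal.exp_log]

theorem tendsto_prod_expNeg (f : ℕ → ENNReal) :
    Tendsto (fun n => ∏ i ∈ Finset.range n, expNeg (f i)) atTop (𝓝 (expNeg (∑' i, f i))) := by
  simp only [← expNeg_sum]
  exact (continuous_expNeg.tendsto _).comp (ENNReal.tendsto_nat_tsum f)

/-- The Laplace functional of a Poisson process with independent marks. -/
theorem IsPoissonProcess.lintegral_expNeg_marks {Ω β : Type*} [mΩ : MeasurableSpace Ω]
    [MeasurableSpace β] {μ : Measure Ω} [IsProbabilityMeasure μ] {u : ℕ → Ω → Plane} {r : ℝ}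
    (h : IsPoissonProcess μ u r) {m : ℕ → Ω → β}
    {A B : ℕ → MeasurableSpace Ω} (hA : ∀ i, A i ≤ mΩ) (hB : ∀ i, B i ≤ mΩ)
    (hind : ∀ i, Indep (A i) (B i) μ) (hu : ∀ i j, Measurable[A i] (u j))
    (hm : ∀ i, Measurable[B i] (m i)) (hmA : ∀ i j, j ≠ i → Measurable[A i] (m j))
    {f : Plane × β → ENNReal} (hf : Measurable f) {g : Plane → ENNReal}
    (hg : ∀ i x, ∫⁻ ω, expNeg (f (x, m i ω)) ∂μ = g x) :
    ∫⁻ ω, expNeg (∑' i, f (u i ω, m i ω)) ∂μ =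
      expNeg (ENNReal.ofReal r * ∫⁻ x, 1 - g x) := by
  have hm' : ∀ i, Measurable (m i) := fun i => (hm i).mono (hB i) le_rfl
  have hgm : Measurable g := by
    have : g = fun x => ∫⁻ ω, expNeg (f (x, m 0 ω)) ∂μ := funext fun x => (hg 0 x).symm
    rw [this]
    exact measurable_lintegral_mark (H := fun p => expNeg (f p)) (hm' 0)
      (measurable_expNeg.comp hf)
  have hg1 : ∀ x, g x ≤ 1 := fun x => by
    rw [← hg 0 x]
    calc ∫⁻ ω, expNeg (f (x, m 0 ω)) ∂μ ≤ ∫⁻ _, 1 ∂μ := lintegral_mono fun ω => expNeg_le_one _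
      _ = 1 := by simp
  -- On average a marked point acts like an unmarked one with deterministic weight -log g, infinite
  -- where g vanishes; this brings the unmarked functional into play.
  set k : Plane → ENNReal := fun x => (-ENNReal.log (g x)).toENNReal with hk
  have hkm : Measurable k :=
    measurable_ereal_toENNReal.comp (ENNReal.measurable_log.comp hgm).neg
  have hgk : ∀ x, g x = expNeg (k x) := fun x => (expNeg_toENNReal_neg_log (hg1 x)).symm
  have hL := h.lintegral_expNeg_tsum hkm
  simp only [← hgk] at hL
  rw [← hL]
  have hdom : ∀ (F : ℕ → Ω → ENNReal), (∀ i, Measurable (F i)) →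
      Tendsto (fun n => ∫⁻ ω, ∏ i ∈ Finset.range n, expNeg (F i ω) ∂μ) atTop
        (𝓝 (∫⁻ ω, expNeg (∑' i, F i ω) ∂μ)) := fun F hF => by
    refine tendsto_lintegral_of_dominated_convergence (fun _ => 1)
      (fun n => Finset.measurable_prod _ fun i _ => measurable_expNeg.comp (hF i))
      (fun n => Eventually.of_forall fun ω => Finset.prod_le_one' fun i _ => expNeg_le_one _)
      (by simp) (Eventually.of_forall fun ω => tendsto_prod_expNeg _)
  have h1 := hdom (fun i ω => f (u i ω, m i ω)) fun i =>
    hf.comp ((h.measurable i).prodMk (hm' i))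
  have h2 := hdom (fun i ω => k (u i ω)) fun i => hkm.comp (h.measurable i)
  refine tendsto_nhds_unique h1 (h2.congr fun n => ?_)
  have h3 := lintegral_prod_marks hA hB hind hu hm hmA (φ := fun p => expNeg (f p))
    (measurable_expNeg.comp hf) hg hgm (Finset.range n) (Y := fun _ => 1)
    fun i => measurable_const
  simp only [mul_one] at h3
  rw [h3]
  simp only [hgk]

/-! ## Gamma and exponential distributions -/

/-- Exponential tilting turns a Gamma density of rate r into a constant times the Gamma density of
rate r + t. For negative t the `ENNReal.ofReal` truncates the exponent to 0, whence max t 0. -/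
theorem lintegral_expNeg_gammaMeasure {c r : ℝ} (hc : 0 < c) (hr : 0 < r) (t : ℝ) :
    ∫⁻ a, expNeg (ENNReal.ofReal (t * a)) ∂gammaMeasure c r =
      ENNReal.ofReal ((r / (r + max t 0)) ^ c) := by
  have hs : 0 < r + max t 0 := by positivity
  have hm : Measurable (gammaPDF c r) := (measurable_gammaPDFReal c r).ennreal_ofReal
  have hm' : Measurable (gammaPDF c (r + max t 0)) :=
    (measurable_gammaPDFReal c _).ennreal_ofReal
  rw [gammaMeasure, lintegral_withDensity_eq_lintegral_mul _ hm
    (show Measurable fun a => expNeg (ENNReal.ofReal (t * a)) from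
      measurable_expNeg.comp (by fun_prop))]
  have h : ∀ a, (gammaPDF c r * fun a => expNeg (ENNReal.ofReal (t * a))) a =
      ENNReal.ofReal ((r / (r + max t 0)) ^ c) * gammaPDF c (r + max t 0) a := by
    intro a
    rw [Pi.mul_apply]
    rcases lt_or_ge a 0 with ha | ha
    · rw [gammaPDF_of_neg ha, gammaPDF_of_neg ha, zero_mul, mul_zero]
    · have e : ENNReal.ofReal (t * a) = ENNReal.ofReal (max t 0 * a) := by
        rw [ENNReal.ofReal_mul' ha, ENNReal.ofReal_mul' ha]
        simp [ENNReal.ofReal_max]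
      rw [e, expNeg_ofReal (by positivity), gammaPDF_of_nonneg ha, gammaPDF_of_nonneg ha,
        ← ENNReal.ofReal_mul' (Real.exp_pos _).le, ← ENNReal.ofReal_mul (by positivity)]
      congr 1
      have e2 : Real.exp (-((r + max t 0) * a)) = Real.exp (-(r * a)) * Real.exp (-(max t 0 * a)) := by
        rw [← Real.exp_add]; congr 1; ring
      have e3 : 0 < (r + max t 0) ^ c := Real.rpow_pos_of_pos hs c
      rw [e2, Real.div_rpow hr.le hs.le]
      have := (Real.Gamma_pos_of_pos hc).ne'
      field_simp
  simp only [h]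
  rw [lintegral_const_mul _ hm', lintegral_gammaPDF_eq_one hc hs, mul_one]

theorem lintegral_expNeg_expMeasure (t : ℝ) :
    ∫⁻ a, expNeg (ENNReal.ofReal (t * a)) ∂expMeasure 1 = ENNReal.ofReal (1 / (1 + max t 0)) := by
  rw [expMeasure, lintegral_expNeg_gammaMeasure one_pos one_pos, Real.rpow_one]

/-- The exponential tail, valid on all of [0, ∞]. The case y = 0 is separate because truncation
makes the event the whole line; there is no atom, so strict and weak inequality agree. -/
theorem expMeasure_le_ofReal (y : ENNReal) :
    expMeasure 1 {h | y ≤ ENNReal.ofReal h} = expNeg y := by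
  have := isProbabilityMeasure_expMeasure one_pos
  by_cases hy : y = ⊤
  · simp [hy, expNeg_top]
  obtain ⟨t, ht, rfl⟩ : ∃ t : ℝ, 0 ≤ t ∧ y = ENNReal.ofReal t :=
    ⟨y.toReal, ENNReal.toReal_nonneg, (ENNReal.ofReal_toReal hy).symm⟩
  rw [expNeg_ofReal ht]
  rcases ht.eq_or_lt with rfl | ht'
  · simp
  have h1 : {h : ℝ | ENNReal.ofReal t ≤ ENNReal.ofReal h} = Set.Ici t := by
    ext h
    change ENNReal.ofReal t ≤ ENNReal.ofReal h ↔ t ≤ h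
    exact ENNReal.ofReal_le_ofReal_iff'.trans ⟨fun h => h.resolve_right (not_le.2 ht'), Or.inl⟩
  have h2 : expMeasure 1 {t} = 0 :=
    withDensity_absolutelyContinuous volume (gammaPDF 1 1) (by simp)
  have h3 : (expMeasure 1).real (Set.Iic t) = 1 - Real.exp (-t) := by
    rw [← cdf_eq_real, cdf_expMeasure_eq one_pos, if_pos ht, one_mul]
  have h4 : expMeasure 1 (Set.Ici t) = expMeasure 1 (Set.Ioi t) := by
    refine le_antisymm ?_ (measure_mono Set.Ioi_subset_Ici_self)
    rw [← Set.Ioi_union_left]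
    exact (measure_union_le _ _).trans (by rw [h2, add_zero])
  rw [h1, h4, ← Set.compl_Iic, ← ENNReal.ofReal_toReal (measure_ne_top (expMeasure 1) _)]
  congr 1
  have h5 := measureReal_compl (μ := expMeasure 1) (measurableSet_Iic (a := t))
  rw [measureReal_def] at h5
  rw [h5, h3]
  simp

/-! ## The distance to the nearest base station -/

section Nearest

variable {Ω : Type*} {u : ℕ → Ω → Plane}

theorem le_infDist_range_iff (ω : Ω) (t : ℝ) :
    t ≤ Metric.infDist 0 (Set.range fun k => u k ω) ↔ ∀ k, t ≤ ‖u k ω‖ := by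
  rw [Metric.le_infDist (Set.range_nonempty _)]
  simp

theorem pointCount_ball_eq_zero_iff (ω : Ω) (t : ℝ) :
    pointCount u (Metric.ball 0 t) ω = 0 ↔ ∀ k, t ≤ ‖u k ω‖ := by
  rw [pointCount, ENNReal.tsum_eq_zero]
  simp

variable [MeasurableSpace Ω] {μ : Measure Ω} {r : ℝ}

theorem IsPoissonProcess.measurable_infDist (h : IsPoissonProcess μ u r) :
    Measurable fun ω => Metric.infDist 0 (Set.range fun k => u k ω) := by
  refine measurable_of_Ici fun t => ?_
  have : (fun ω => Metric.infDist 0 (Set.range fun k => u k ω)) ⁻¹' Set.Ici t =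
      ⋂ k, (fun ω => ‖u k ω‖) ⁻¹' Set.Ici t := by
    ext ω
    rw [Set.mem_iInter]
    exact le_infDist_range_iff ω t
  rw [this]
  exact MeasurableSet.iInter fun k => (h.measurable k).norm measurableSet_Ici

/-- The mean square distance to the nearest point of a Poisson process. -/
theorem IsPoissonProcess.lintegral_infDist_sq (h : IsPoissonProcess μ u r) (hr : 0 < r) :
    ∫⁻ ω, ENNReal.ofReal (Metric.infDist 0 (Set.range fun k => u k ω) ^ 2) ∂μ =
      ENNReal.ofReal (1 / (Real.pi * r)) := by
  -- Layer-cake formula: R² ≥ t says that the open disc of radius √t is empty, which has probability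
  -- exp(-π r t).
  rw [lintegral_eq_lintegral_meas_le μ (Eventually.of_forall fun ω => sq_nonneg _)
    (h.measurable_infDist.pow_const 2).aemeasurable]
  have hpi := Real.pi_pos
  have h1 : ∀ t ∈ Set.Ioi (0 : ℝ),
      μ {ω | t ≤ Metric.infDist 0 (Set.range fun k => u k ω) ^ 2} =
        ENNReal.ofReal (Real.exp (-(Real.pi * r) * t)) := by
    intro t ht
    have ht0 : 0 < t := ht
    have h2 : {ω | t ≤ Metric.infDist 0 (Set.range fun k => u k ω) ^ 2} =
        {ω | pointCount u (Metric.ball 0 √t) ω = (0 : ℕ)} := by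
      ext ω
      change t ≤ _ ↔ pointCount u (Metric.ball 0 √t) ω = (0 : ℕ)
      rw [Nat.cast_zero, pointCount_ball_eq_zero_iff, ← le_infDist_range_iff,
        Real.sqrt_le_left Metric.infDist_nonneg]
    have h3 : (volume (Metric.ball (0 : Plane) √t)).toReal = t * Real.pi := by
      rw [EuclideanSpace.volume_ball_fin_two, ← ENNReal.ofReal_pow (Real.sqrt_nonneg t),
        Real.sq_sqrt ht0.le, ← ENNReal.ofReal_mul ht0.le, ENNReal.toReal_ofReal (by positivity)]
    rw [h2, h.count_law _ measurableSet_ball measure_ball_lt_top, poissonMeasure_singleton, h3,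
      Real.coe_toNNReal _ (by positivity)]
    simp only [pow_zero, Nat.factorial_zero, Nat.cast_one, mul_one, div_one]
    congr 2
    ring
  rw [setLIntegral_congr_fun measurableSet_Ioi h1]
  have hneg : -(Real.pi * r) < 0 := by
    have : 0 < Real.pi * r := by positivity
    linarith
  rw [← ofReal_integral_eq_lintegral_ofReal (integrableOn_exp_mul_Ioi hneg 0)
    (Eventually.of_forall fun t => (Real.exp_pos _).le), integral_exp_mul_Ioi hneg]
  congr 1
  simp

end Nearest

/-! ## The interference integral -/

/-- Probability that an interferer at distance `y` matters, for a power control radius of one. -/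
def interferenceKernel (eta theta y : ℝ) : ℝ :=
  if 1 < y then 1 - 1 / (1 + theta * y ^ (-eta)) else 0

section Kernel

variable {eta theta : ℝ}

theorem interferenceKernel_nonneg (htheta : 0 < theta) (y : ℝ) :
    0 ≤ interferenceKernel eta theta y := by
  rw [interferenceKernel]
  split_ifs with h
  · have hy : 0 < y := by linarith
    have h1 : 0 ≤ theta * y ^ (-eta) := by positivity
    rw [sub_nonneg, div_le_one (by positivity)]
    linarith
  · exact le_rfl

/-- Here c - b = 1, so the power of 1 - t disappears and the Gamma quotient collapses to b. -/
theorem gaussHypergeometric_one_eq (heta : 2 < eta) :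
    gaussHypergeometric 1 (1 - 2 / eta) (2 - 2 / eta) (-theta) =
      (1 - 2 / eta) * ∫ t in Set.Ioo (0 : ℝ) 1, t ^ (-(2 / eta)) * (1 + theta * t)⁻¹ := by
  have h1 : 2 / eta < 1 := (div_lt_one (by linarith)).2 heta
  have hb : 0 < 1 - 2 / eta := by linarith
  have e : 2 - 2 / eta = (1 - 2 / eta) + 1 := by ring
  have hG : Real.Gamma (1 - 2 / eta) ≠ 0 := (Real.Gamma_pos_of_pos hb).ne'
  rw [gaussHypergeometric, e, Real.Gamma_add_one hb.ne', add_sub_cancel_left, Real.Gamma_one,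
    mul_one, mul_div_assoc, div_self hG, mul_one]
  congr 1
  refine setIntegral_congr_fun measurableSet_Ioo fun t ht => ?_
  rw [sub_self, Real.rpow_zero, mul_one, Real.rpow_neg_one]
  congr 2 <;> ring

theorem integrableOn_eulerIntegrand (heta : 2 < eta) (htheta : 0 < theta) :
    IntegrableOn (fun t : ℝ => t ^ (-(2 / eta)) * (1 + theta * t)⁻¹) (Set.Ioo 0 1) := by
  have h1 : 2 / eta < 1 := (div_lt_one (by linarith)).2 heta
  have h := intervalIntegral.intervalIntegrable_rpow' (a := 0) (b := 1) (r := -(2 / eta))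
    (by linarith)
  rw [intervalIntegrable_iff_integrableOn_Ioo_of_le zero_le_one] at h
  refine Integrable.mono' h (by fun_prop) ?_
  refine (ae_restrict_iff' measurableSet_Ioo).2 (Eventually.of_forall fun t ht => ?_)
  have ht0 := ht.1
  rw [Real.norm_of_nonneg (by positivity)]
  refine mul_le_of_le_one_right (by positivity) (inv_le_one_of_one_le₀ ?_)
  nlinarith

/-- The substitution y = t^(-1/η), with its Jacobian, turns θ y^(-η) into θ t and the range y > 1
into 0 < t < 1, producing Euler's integrand. -/
theorem kernel_substitution (heta : 2 < eta) (htheta : 0 < theta) {t : ℝ} (ht : 0 < t) :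
    (|-(1 / eta)| * t ^ (-(1 / eta) - 1)) •
        (t ^ (-(1 / eta)) * interferenceKernel eta theta (t ^ (-(1 / eta)))) =
      (Set.Ioo (0 : ℝ) 1).indicator
        (fun t => theta / eta * (t ^ (-(2 / eta)) * (1 + theta * t)⁻¹)) t := by
  have he : 0 < 1 / eta := by positivity
  have hiff : 1 < t ^ (-(1 / eta)) ↔ t < 1 := by
    rw [Real.one_lt_rpow_iff_of_pos ht]
    constructor
    · rintro (⟨-, h⟩ | ⟨h, -⟩)
      · linarith
      · exact h
    · exact fun h => Or.inr ⟨h, by linarith⟩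
  by_cases h1 : t < 1
  · have e1 : (t ^ (-(1 / eta))) ^ (-eta) = t := by
      rw [← Real.rpow_mul ht.le, show -(1 / eta) * -eta = 1 by field_simp, Real.rpow_one]
    have e2 : t ^ (-(2 / eta)) = t ^ (-(1 / eta) - 1) * t ^ (-(1 / eta)) * t := by
      nth_rw 4 [← Real.rpow_one t]
      rw [← Real.rpow_add ht, ← Real.rpow_add ht]
      congr 1
      ring
    rw [Set.indicator_of_mem (show t ∈ Set.Ioo (0 : ℝ) 1 from ⟨ht, h1⟩), interferenceKernel,
      if_pos (hiff.2 h1), e1, e2, abs_neg, abs_of_pos he, smul_eq_mul]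
    have : 1 + theta * t ≠ 0 := by positivity
    field_simp
    ring
  · rw [Set.indicator_of_notMem (fun h => h1 h.2), interferenceKernel,
      if_neg (fun h => h1 (hiff.1 h))]
    simp

theorem integrableOn_kernel (heta : 2 < eta) (htheta : 0 < theta) :
    IntegrableOn (fun y => y * interferenceKernel eta theta y) (Set.Ioi 0) := by
  have hp : -(1 / eta) ≠ 0 := by
    have : 0 < 1 / eta := by positivity
    linarith
  rw [← integrableOn_Ioi_comp_rpow_iff _ hp]
  refine IntegrableOn.congr_fun ?_ (fun t ht => (kernel_substitution heta htheta ht).symm)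
    measurableSet_Ioi
  have := (integrableOn_eulerIntegrand heta htheta).const_mul (theta / eta)
  exact (((integrable_indicator_iff measurableSet_Ioo).2 this)).integrableOn

theorem integral_kernel (heta : 2 < eta) (htheta : 0 < theta) :
    ∫ y in Set.Ioi (0 : ℝ), y * interferenceKernel eta theta y =
      theta / (eta - 2) * gaussHypergeometric 1 (1 - 2 / eta) (2 - 2 / eta) (-theta) := by
  have hp : -(1 / eta) ≠ 0 := by
    have : 0 < 1 / eta := by positivity
    linarith
  rw [← integral_comp_rpow_Ioi _ hp, setIntegral_congr_fun measurableSet_Ioi fun t ht =>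
    kernel_substitution heta htheta ht, setIntegral_indicator measurableSet_Ioo,
    Set.inter_eq_right.2 Set.Ioo_subset_Ioi_self, integral_const_mul,
    gaussHypergeometric_one_eq heta]
  have h1 : eta ≠ 0 := by linarith
  have h2 : eta - 2 ≠ 0 := by linarith
  field_simp

/-- Polar coordinates give 2π times the radial integral, and rescaling the radius by R gives R². -/
theorem lintegral_kernel_norm (heta : 2 < eta) (htheta : 0 < theta) {R : ℝ} (hR : 0 < R) :
    ∫⁻ x : Plane, ENNReal.ofReal (interferenceKernel eta theta (R⁻¹ * ‖x‖)) =
      ENNReal.ofReal (2 * Real.pi * (theta / (eta - 2) *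
        gaussHypergeometric 1 (1 - 2 / eta) (2 - 2 / eta) (-theta)) * R ^ 2) := by
  have hfr : Module.finrank ℝ Plane = 2 := by simp
  have e : ∀ y : ℝ, y * interferenceKernel eta theta (R⁻¹ * y) =
      R * ((R⁻¹ * y) * interferenceKernel eta theta (R⁻¹ * y)) := fun y => by
    field_simp
  have hint : IntegrableOn (fun y : ℝ => y * interferenceKernel eta theta (R⁻¹ * y))
      (Set.Ioi 0) := by
    simp only [e]
    refine Integrable.const_mul ?_ R
    have := (integrableOn_Ioi_comp_mul_left_iff
      (fun y => y * interferenceKernel eta theta y) 0 (inv_pos.2 hR)).2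
      (by rw [mul_zero]; exact integrableOn_kernel heta htheta)
    exact this
  have hI : Integrable (fun x : Plane => interferenceKernel eta theta (R⁻¹ * ‖x‖)) := by
    refine (integrable_fun_norm_addHaar (E := Plane) volume
      (f := fun y => interferenceKernel eta theta (R⁻¹ * y))).2 ?_
    simpa [hfr] using hint
  rw [← ofReal_integral_eq_lintegral_ofReal hI (Eventually.of_forall fun x =>
    interferenceKernel_nonneg htheta _)]
  congr 1
  have h1 := integral_fun_norm_addHaar (E := Plane) volume
      (fun y => interferenceKernel eta theta (R⁻¹ * y))
  have h2 := integral_comp_mul_left_Ioi (fun y => y * interferenceKernel eta theta y) 0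
    (inv_pos.2 hR)
  rw [mul_zero, integral_kernel heta htheta, inv_inv] at h2
  have h3 : (volume : Measure Plane).real (Metric.ball 0 1) = Real.pi := by
    rw [measureReal_def, EuclideanSpace.volume_ball_fin_two]
    simp [Real.pi_pos.le]
  rw [h1, hfr, h3]
  simp only [Nat.add_one_sub_one, pow_one, smul_eq_mul, nsmul_eq_mul] at h2 ⊢
  simp only [e]
  rw [integral_const_mul, h2]
  push_cast
  ring

end Kernel

/-! ## σ-algebras generated by groups of sources -/

section Network

variable {Ω : Type*}

/-- The σ-algebra generated by a set of sources. -/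
@[reducible] def Variables.sig {N : ℕ} (V : Variables Ω N) (S : Set Source) : MeasurableSpace Ω :=
  ⨆ s ∈ S, V.sigma s

namespace Variables

variable {N : ℕ} (V : Variables Ω N) {S : Set Source}

theorem sigma_le_sig {s : Source} (hs : s ∈ S) : V.sigma s ≤ V.sig S :=
  le_iSup₂ (f := fun s (_ : s ∈ S) => V.sigma s) s hs

theorem measurable_loc (hs : Source.loc ∈ S) (i : ℕ) : Measurable[V.sig S] (V.loc i) := by
  have h1 : Measurable[V.sigma .loc] (fun ω i => V.loc i ω) := comap_measurable _
  exact ((measurable_pi_apply i).comp h1).mono (V.sigma_le_sig hs) le_rfl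

theorem measurable_state {i : ℕ} (hs : Source.state i ∈ S) : Measurable[V.sig S] (V.state i) :=
  have h1 : Measurable[V.sigma (.state i)] (V.state i) := comap_measurable _
  h1.mono (V.sigma_le_sig hs) le_rfl

theorem measurable_power {i : ℕ} (hs : Source.power i ∈ S) : Measurable[V.sig S] (V.power i) :=
  have h1 : Measurable[V.sigma (.power i)] (V.power i) := comap_measurable _
  h1.mono (V.sigma_le_sig hs) le_rfl

theorem measurable_fading {i : ℕ} (hs : Source.fading i ∈ S) :
    Measurable[V.sig S] (V.fading i) :=
  have h1 : Measurable[V.sigma (.fading i)] (V.fading i) := comap_measurable _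
  h1.mono (V.sigma_le_sig hs) le_rfl

theorem measurable_cellCount (hs : Source.cellCount ∈ S) : Measurable[V.sig S] V.cellCount :=
  have h1 : Measurable[V.sigma .cellCount] V.cellCount := comap_measurable _
  h1.mono (V.sigma_le_sig hs) le_rfl

theorem measurable_cellState {n : ℕ} (hs : Source.cellState n ∈ S) :
    Measurable[V.sig S] (V.cellState n) :=
  have h1 : Measurable[V.sigma (.cellState n)] (V.cellState n) := comap_measurable _
  h1.mono (V.sigma_le_sig hs) le_rfl

theorem measurable_cellFading {n : ℕ} (hs : Source.cellFading n ∈ S) :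
    Measurable[V.sig S] (V.cellFading n) :=
  have h1 : Measurable[V.sigma (.cellFading n)] (V.cellFading n) := comap_measurable _
  h1.mono (V.sigma_le_sig hs) le_rfl

theorem measurable_signal (hs : Source.signal ∈ S) : Measurable[V.sig S] V.signal :=
  have h1 : Measurable[V.sigma .signal] V.signal := comap_measurable _
  h1.mono (V.sigma_le_sig hs) le_rfl

end Variables

/-- Contribution of an interferer at `x` with state, power and gain `m`. -/
def interTerm (prm : Parameters) (z : Plane × BackoffState prm.N × ℝ × ℝ) : ENNReal :=
  if z.2.1 = 0 ∧ z.2.2.1 * ‖z.1‖ ^ (-prm.eta) < prm.rho then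
    ENNReal.ofReal (z.2.2.1 * z.2.2.2 * ‖z.1‖ ^ (-prm.eta)) else 0

/-- Contribution of a device of the cell with given state and gain. -/
def intraTerm (prm : Parameters) (z : BackoffState prm.N × ℝ) : ENNReal :=
  if z.1 = 0 then ENNReal.ofReal (prm.rho * z.2) else 0

theorem measurable_interTerm (prm : Parameters) : Measurable (interTerm prm) := by
  have h : Measurable fun z : Plane × BackoffState prm.N × ℝ × ℝ =>
      ENNReal.ofReal (z.2.2.1 * z.2.2.2 * ‖z.1‖ ^ (-prm.eta)) := by fun_prop
  refine Measurable.ite (MeasurableSet.inter ?_ ?_) h measurable_const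
  · exact (measurableSet_singleton (0 : BackoffState prm.N)).preimage
      (measurable_fst.comp measurable_snd)
  · have h' : Measurable fun z : Plane × BackoffState prm.N × ℝ × ℝ =>
        z.2.2.1 * ‖z.1‖ ^ (-prm.eta) := by fun_prop
    exact measurableSet_lt h' measurable_const

theorem measurable_intraTerm (prm : Parameters) : Measurable (intraTerm prm) := by
  have h : Measurable fun z : BackoffState prm.N × ℝ => ENNReal.ofReal (prm.rho * z.2) := by
    fun_prop
  refine Measurable.ite ?_ h measurable_const
  exact (measurableSet_singleton (0 : BackoffState prm.N)).preimage measurable_fst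

variable {prm : Parameters} (V : Variables Ω prm.N)

theorem interInterference_eq (ω : Ω) : interInterference prm V ω =
    ∑' i, interTerm prm (V.loc i ω, V.state i ω, V.power i ω, V.fading i ω) := rfl

theorem intraInterference_eq (ω : Ω) : intraInterference prm V ω =
    ∑ n ∈ Finset.range (V.cellCount ω), intraTerm prm (V.cellState n ω, V.cellFading n ω) := rfl

theorem measurable_interInterference {S : Set Source} (h0 : Source.loc ∈ S)
    (h1 : ∀ i, Source.state i ∈ S) (h2 : ∀ i, Source.power i ∈ S) (h3 : ∀ i, Source.fading i ∈ S) :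
    Measurable[V.sig S] (interInterference prm V) :=
  @Measurable.tsum Ω ENNReal ℕ (V.sig S) _ _ _ _ _ _ _ _ _ _ _ _ fun i =>
    (measurable_interTerm prm).comp ((V.measurable_loc h0 i).prodMk
      ((V.measurable_state (h1 i)).prodMk
        ((V.measurable_power (h2 i)).prodMk (V.measurable_fading (h3 i)))))

/-- A sum with a random number of terms is measurable jointly in the number and the sequence, since
the number ranges over a countable set. -/
theorem measurable_intraInterference {S : Set Source} (h0 : Source.cellCount ∈ S)
    (h1 : ∀ n, Source.cellState n ∈ S) (h2 : ∀ n, Source.cellFading n ∈ S) :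
    Measurable[V.sig S] (intraInterference prm V) := by
  have h : Measurable fun p : ℕ × (ℕ → ENNReal) => ∑ n ∈ Finset.range p.1, p.2 n :=
    measurable_from_prod_countable_right fun k =>
      Finset.measurable_sum (Finset.range k) fun n _ => measurable_pi_apply n
  exact h.comp ((V.measurable_cellCount h0).prodMk
    (@measurable_pi_lambda _ _ _ (V.sig S) _ _ fun n => (measurable_intraTerm prm).comp
      ((V.measurable_cellState (h1 n)).prodMk (V.measurable_cellFading (h2 n)))))

namespace IsBackoffNetwork

variable [mΩ : MeasurableSpace Ω] {x : BackoffState prm.N → ℝ} {μ : Measure Ω}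
  {V : Variables Ω prm.N}

theorem sigma_le (hV : IsBackoffNetwork prm x μ V) (s : Source) : V.sigma s ≤ mΩ := by
  cases s with
  | loc => exact (measurable_pi_lambda _ hV.loc_poisson.measurable).comap_le
  | state i => exact (hV.state_law i).1.comap_le
  | power i => exact (hV.power_law i).1.comap_le
  | fading i => exact (hV.fading_law i).1.comap_le
  | cellCount => exact hV.cellCount_law.1.comap_le
  | cellState n => exact (hV.cellState_law n).1.comap_le
  | cellFading n => exact (hV.cellFading_law n).1.comap_le
  | signal => exact hV.signal_law.1.comap_le

theorem sig_le (hV : IsBackoffNetwork prm x μ V) (S : Set Source) : V.sig S ≤ mΩ :=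
  iSup₂_le fun s _ => hV.sigma_le s

/-- Joint independence of the sources passes to disjoint groups of them; all independence between
different random quantities of the network is drawn from here. -/
theorem indep_sig (hV : IsBackoffNetwork prm x μ V) {S T : Set Source} (hST : Disjoint S T) :
    Indep (V.sig S) (V.sig T) μ :=
  indep_iSup_of_disjoint hV.sigma_le hV.indep hST

end IsBackoffNetwork

end Network

/-! ## Laplace transforms of marks -/

section MarkLaplace

variable {Ω : Type*} [MeasurableSpace Ω] {μ : Measure Ω}

theorem lintegral_ite_eq_mul {β γ : Type*} [MeasurableSpace β] [MeasurableSingletonClass β]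
    [DecidableEq β] [MeasurableSpace γ] {X : Ω → β} {Y : Ω → γ} (hX : Measurable X)
    (hY : Measurable Y) (hind : IndepFun X Y μ) (b : β) {ψ : γ → ENNReal} (hψ : Measurable ψ) :
    ∫⁻ ω, (if X ω = b then ψ (Y ω) else 0) ∂μ = μ {ω | X ω = b} * ∫⁻ ω, ψ (Y ω) ∂μ := by
  have h1 : Measurable fun k => Set.indicator {b} (fun _ => (1 : ENNReal)) k :=
    measurable_const.indicator (measurableSet_singleton b)
  have h2 := lintegral_mul_eq_lintegral_mul_lintegral_of_indepFun (h1.comp hX) (hψ.comp hY)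
    (hind.comp h1 hψ)
  have h3 : ∫⁻ ω, ((fun k => Set.indicator {b} (fun _ => (1 : ENNReal)) k) ∘ X) ω ∂μ =
      μ {ω | X ω = b} := by
    have : ((fun k => Set.indicator {b} (fun _ => (1 : ENNReal)) k) ∘ X) =
        (X ⁻¹' {b}).indicator 1 := by
      funext ω
      by_cases h : X ω = b <;> simp [h]
    rw [this, lintegral_indicator_one (hX (measurableSet_singleton b))]
    rfl
  rw [h3] at h2
  refine Eq.trans (lintegral_congr fun ω => ?_) h2
  by_cases h : X ω = b <;> simp [h]

variable [IsProbabilityMeasure μ]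

theorem lintegral_one_sub {f : Ω → ENNReal} (hf : Measurable f) (h1 : ∀ ω, f ω ≤ 1) :
    ∫⁻ ω, 1 - f ω ∂μ = 1 - ∫⁻ ω, f ω ∂μ := by
  have h2 : ∫⁻ ω, f ω ∂μ ≤ 1 := (lintegral_mono h1).trans (by simp)
  rw [lintegral_sub hf (h2.trans_lt ENNReal.one_lt_top).ne (Eventually.of_forall h1)]
  simp

theorem lintegral_eq_one_sub {f : Ω → ENNReal} (hf : Measurable f) (h1 : ∀ ω, f ω ≤ 1) :
    ∫⁻ ω, f ω ∂μ = 1 - ∫⁻ ω, 1 - f ω ∂μ := by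
  have h2 : ∫⁻ ω, f ω ∂μ ≤ 1 := (lintegral_mono h1).trans (by simp)
  rw [lintegral_one_sub hf h1, ENNReal.sub_sub_cancel ENNReal.one_ne_top h2]

theorem lintegral_one_sub_expNeg_exp {h : Ω → ℝ} (hh : Measurable h)
    (hlaw : μ.map h = expMeasure 1) (t : ℝ) :
    ∫⁻ ω, 1 - expNeg (ENNReal.ofReal (t * h ω)) ∂μ =
      ENNReal.ofReal (1 - 1 / (1 + max t 0)) := by
  have hm : Measurable fun ω => expNeg (ENNReal.ofReal (t * h ω)) :=
    measurable_expNeg.comp (by fun_prop)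
  rw [lintegral_one_sub hm fun _ => expNeg_le_one _, ← lintegral_map (f := fun a => expNeg (ENNReal.ofReal (t * a)))
      (measurable_expNeg.comp (by fun_prop)) hh, hlaw, lintegral_expNeg_expMeasure,
    ENNReal.ofReal_sub _ (by positivity), ENNReal.ofReal_one]

end MarkLaplace

/-! ## Inter-cell interference -/

section Inter

/-- The mean effect of a transmitting interferer at `y` with power `p`. -/
def powerEffect (prm : Parameters) (y p : ℝ) : ENNReal :=
  if p * y ^ (-prm.eta) < prm.rho then
    ENNReal.ofReal (1 - 1 / (1 + max (prm.theta / prm.rho * (p * y ^ (-prm.eta))) 0)) else 0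

theorem measurable_powerEffect (prm : Parameters) (y : ℝ) : Measurable (powerEffect prm y) := by
  have h1 : Measurable fun p : ℝ => p * y ^ (-prm.eta) := by fun_prop
  have h2 : Measurable fun p : ℝ => ENNReal.ofReal
      (1 - 1 / (1 + max (prm.theta / prm.rho * (p * y ^ (-prm.eta))) 0)) := by fun_prop
  exact Measurable.ite (measurableSet_lt h1 measurable_const) h2 measurable_const

theorem interferenceKernel_zero (eta theta : ℝ) : interferenceKernel eta theta 0 = 0 :=
  if_neg (by norm_num)

/-- With power ρ R^η the mean received power is ρ (y/R)^(-η), so ρ cancels and the cut-off reads y >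
R. At R = 0 or y = 0 the default values of inverse and power make both sides vanish. -/
theorem powerEffect_eq {prm : Parameters} (hrho : 0 < prm.rho) (htheta : 0 < prm.theta)
    (heta : 2 < prm.eta) {y R : ℝ} (hy : 0 ≤ y) (hR : 0 ≤ R) :
    powerEffect prm y (prm.rho * R ^ prm.eta) =
      ENNReal.ofReal (interferenceKernel prm.eta prm.theta (R⁻¹ * y)) := by
  have he : 0 < prm.eta := by linarith
  rcases hR.eq_or_lt with rfl | hR
  · simp [powerEffect, interferenceKernel_zero, Real.zero_rpow he.ne']
  rcases hy.eq_or_lt with rfl | hy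
  · simp [powerEffect, interferenceKernel_zero, Real.zero_rpow (neg_ne_zero.2 he.ne')]
  have hpos : 0 < R⁻¹ * y := by positivity
  have e : R ^ prm.eta * y ^ (-prm.eta) = (R⁻¹ * y) ^ (-prm.eta) := by
    rw [Real.mul_rpow (by positivity) hy.le, Real.inv_rpow hR.le, Real.rpow_neg hR.le, inv_inv]
  have hiff : prm.rho * R ^ prm.eta * y ^ (-prm.eta) < prm.rho ↔ 1 < R⁻¹ * y := by
    rw [mul_assoc, e, mul_lt_iff_lt_one_right hrho, Real.rpow_lt_one_iff_of_pos hpos]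
    constructor
    · rintro (⟨h, -⟩ | ⟨-, h⟩)
      · exact h
      · linarith
    · exact fun h => Or.inl ⟨h, by linarith⟩
  have e2 : prm.theta / prm.rho * (prm.rho * R ^ prm.eta * y ^ (-prm.eta)) =
      prm.theta * (R⁻¹ * y) ^ (-prm.eta) := by
    rw [← e]; field_simp
  rw [powerEffect, interferenceKernel, e2, max_eq_left (by positivity)]
  by_cases h : 1 < R⁻¹ * y
  · rw [if_pos h, if_pos (hiff.2 h)]
  · rw [if_neg h, if_neg fun h' => h (hiff.1 h'), ENNReal.ofReal_zero]

variable {prm : Parameters} {Ω : Type*} [mΩ : MeasurableSpace Ω] {x : BackoffState prm.N → ℝ} {μ : Measure Ω}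
  {V : Variables Ω prm.N}

/-- One minus the Laplace transform of the contribution of a device at `z`. -/
theorem IsBackoffNetwork.lintegral_interTerm (hrho : 0 < prm.rho)
    (htheta : 0 < prm.theta) (heta : 2 < prm.eta) (hV : IsBackoffNetwork prm x μ V) (i : ℕ)
    (z : Plane) :
    ∫⁻ ω, 1 - expNeg (ENNReal.ofReal (prm.theta / prm.rho) *
        interTerm prm (z, V.state i ω, V.power i ω, V.fading i ω)) ∂μ =
      ENNReal.ofReal (x 0) * ∫⁻ ω, ENNReal.ofReal (interferenceKernel prm.eta prm.theta
        ((Metric.infDist 0 (Set.range fun k => V.bs k ω))⁻¹ * ‖z‖)) ∂μ := by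
  have := hV.prob
  have hs : 0 < prm.theta / prm.rho := by positivity
  let ψ : ℝ × ℝ → ENNReal := fun p => if p.1 * ‖z‖ ^ (-prm.eta) < prm.rho then
    1 - expNeg (ENNReal.ofReal (prm.theta / prm.rho * (p.1 * ‖z‖ ^ (-prm.eta)) * p.2)) else 0
  have hψ : Measurable ψ := by
    have h1 : Measurable fun p : ℝ × ℝ => p.1 * ‖z‖ ^ (-prm.eta) := by fun_prop
    have h2 : Measurable fun p : ℝ × ℝ => ENNReal.ofReal
      (prm.theta / prm.rho * (p.1 * ‖z‖ ^ (-prm.eta)) * p.2) := by fun_prop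
    exact Measurable.ite (measurableSet_lt h1 measurable_const)
      (measurable_const.sub (measurable_expNeg.comp h2)) measurable_const
  have hterm : ∀ ω, 1 - expNeg (ENNReal.ofReal (prm.theta / prm.rho) *
      interTerm prm (z, V.state i ω, V.power i ω, V.fading i ω)) =
      if V.state i ω = 0 then ψ (V.power i ω, V.fading i ω) else 0 := fun ω => by
    simp only [interTerm, ψ]
    by_cases h0 : V.state i ω = 0 <;>
      by_cases h1 : V.power i ω * ‖z‖ ^ (-prm.eta) < prm.rho <;>
      simp only [h0, h1, and_self, and_false, false_and, if_true, if_false, mul_zero, expNeg_zero,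
        tsub_self]
    rw [← ENNReal.ofReal_mul hs.le]
    congr 3
    ring
  have hind1 : IndepFun (V.state i) (fun ω => (V.power i ω, V.fading i ω)) μ :=
    indepFun_of_indep (hV.indep_sig (S := {.state i}) (T := {.power i, .fading i}) (by simp))
      (V.measurable_state (by simp))
      ((V.measurable_power (by simp)).prodMk (V.measurable_fading (by simp)))
  have hind2 : IndepFun (V.power i) (V.fading i) μ :=
    indepFun_of_indep (hV.indep_sig (S := {.power i}) (T := {.fading i}) (by simp))
      (V.measurable_power (by simp)) (V.measurable_fading (by simp))
  have hψ2 : ∫⁻ ω, ψ (V.power i ω, V.fading i ω) ∂μ =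
      ∫⁻ ω, powerEffect prm ‖z‖ (V.power i ω) ∂μ := by
    rw [lintegral_indepFun (hV.power_law i).1 (hV.fading_law i).1 hind2 hψ]
    refine lintegral_congr fun ω => ?_
    simp only [ψ, powerEffect]
    by_cases h1 : V.power i ω * ‖z‖ ^ (-prm.eta) < prm.rho
    · simp only [h1, if_true]
      exact lintegral_one_sub_expNeg_exp (hV.fading_law i).1 (hV.fading_law i).2 _
    · simp [h1]
  simp only [hterm]
  rw [lintegral_ite_eq_mul (hV.state_law i).1 ((hV.power_law i).1.prodMk (hV.fading_law i).1)
    hind1 0 hψ, (hV.state_law i).2, hψ2]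
  congr 1
  -- The power enters only through its law, so it may be replaced by ρ R^η with R the distance to
  -- the nearest base station.
  have h3 := ((hV.power_law i).2.comp (measurable_powerEffect prm ‖z‖)).lintegral_eq
  refine h3.trans (lintegral_congr fun ω => ?_)
  exact powerEffect_eq hrho htheta heta (norm_nonneg z) Metric.infDist_nonneg

theorem measurable_interferenceKernel (eta theta : ℝ) :
    Measurable (interferenceKernel eta theta) := by
  have h : Measurable fun y : ℝ => 1 - 1 / (1 + theta * y ^ (-eta)) := by fun_prop
  exact Measurable.ite measurableSet_Ioi h measurable_const

/-- The Laplace transform of the inter-cell interference. -/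
theorem IsBackoffNetwork.lintegral_expNeg_inter (hlam : 0 < prm.lam) (hrho : 0 < prm.rho)
    (htheta : 0 < prm.theta) (heta : 2 < prm.eta) (hV : IsBackoffNetwork prm x μ V) (hx : 0 ≤ x 0) :
    ∫⁻ ω, expNeg (ENNReal.ofReal (prm.theta / prm.rho) * interInterference prm V ω) ∂μ =
      expNeg (ENNReal.ofReal (2 * prm.theta * prm.devInt / ((prm.eta - 2) * prm.lam) *
        gaussHypergeometric 1 (1 - 2 / prm.eta) (2 - 2 / prm.eta) (-prm.theta) * x 0)) := by
  have := hV.prob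
  let S : ℕ → Set Source := fun i => {.state i, .power i, .fading i}
  let f : Plane × BackoffState prm.N × ℝ × ℝ → ENNReal := fun z =>
    ENNReal.ofReal (prm.theta / prm.rho) * interTerm prm z
  have hf : Measurable f := measurable_const.mul (measurable_interTerm prm)
  let m : ℕ → Ω → BackoffState prm.N × ℝ × ℝ := fun i ω =>
    (V.state i ω, V.power i ω, V.fading i ω)
  have hm : ∀ i, Measurable (m i) := fun i =>
    (hV.state_law i).1.prodMk ((hV.power_law i).1.prodMk (hV.fading_law i).1)
  let J : Plane → ENNReal := fun z => ENNReal.ofReal (x 0) * ∫⁻ ω, ENNReal.ofReal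
    (interferenceKernel prm.eta prm.theta
      ((Metric.infDist 0 (Set.range fun k => V.bs k ω))⁻¹ * ‖z‖)) ∂μ
  have hJ : ∀ i z, ∫⁻ ω, 1 - expNeg (f (z, m i ω)) ∂μ = J z := fun i z =>
    hV.lintegral_interTerm hrho htheta heta i z
  have hfm : ∀ i z, Measurable fun ω => expNeg (f (z, m i ω)) := fun i z =>
    measurable_expNeg.comp (hf.comp (measurable_const.prodMk (hm i)))
  have hg : ∀ i z, ∫⁻ ω, expNeg (f (z, m i ω)) ∂μ = 1 - J z := fun i z => by
    rw [← hJ i z]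
    exact lintegral_eq_one_sub (hfm i z) fun _ => expNeg_le_one _
  have hJ1 : ∀ z, J z ≤ 1 := fun z => by
    rw [← hJ 0 z]
    exact (lintegral_mono fun _ => tsub_le_self).trans (by simp)
  have hL := hV.loc_poisson.lintegral_expNeg_marks (m := m)
    (A := fun i => V.sig (S i)ᶜ) (B := fun i => V.sig (S i))
    (fun i => hV.sig_le _) (fun i => hV.sig_le _)
    (fun i => hV.indep_sig disjoint_compl_left)
    (fun i j => V.measurable_loc (by simp [S]) j)
    (fun i => (V.measurable_state (by simp [S])).prodMk
      ((V.measurable_power (by simp [S])).prodMk (V.measurable_fading (by simp [S]))))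
    (fun i j hij => (V.measurable_state (by simp [S, hij])).prodMk
      ((V.measurable_power (by simp [S, hij])).prodMk (V.measurable_fading (by simp [S, hij]))))
    hf hg
  have hsum : ∀ ω, ENNReal.ofReal (prm.theta / prm.rho) * interInterference prm V ω =
      ∑' i, f (V.loc i ω, m i ω) := fun ω => by
    rw [interInterference_eq, ← ENNReal.tsum_mul_left]
  simp only [hsum]
  rw [hL]
  simp only [ENNReal.sub_sub_cancel ENNReal.one_ne_top (hJ1 _)]
  have hR := hV.bs_poisson.measurable_infDist
  have hker : Measurable fun p : Plane × Ω => ENNReal.ofReal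
      (interferenceKernel prm.eta prm.theta
        ((Metric.infDist 0 (Set.range fun k => V.bs k p.2))⁻¹ * ‖p.1‖)) :=
    ((measurable_interferenceKernel _ _).comp
      ((hR.comp measurable_snd).inv.mul measurable_fst.norm)).ennreal_ofReal
  have hinner : ∀ ω, ∫⁻ z : Plane, ENNReal.ofReal (interferenceKernel prm.eta prm.theta
      ((Metric.infDist 0 (Set.range fun k => V.bs k ω))⁻¹ * ‖z‖)) =
      ENNReal.ofReal (2 * Real.pi * (prm.theta / (prm.eta - 2) *
        gaussHypergeometric 1 (1 - 2 / prm.eta) (2 - 2 / prm.eta) (-prm.theta))) *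
      ENNReal.ofReal (Metric.infDist 0 (Set.range fun k => V.bs k ω) ^ 2) := fun ω => by
    -- If R = 0, then R⁻¹ = 0 and the kernel vanishes, in agreement with R² = 0.
    rcases (Metric.infDist_nonneg (x := (0 : Plane))
      (s := Set.range fun k => V.bs k ω)).eq_or_lt with h | h
    · rw [← h]
      simp [interferenceKernel_zero]
    · rw [lintegral_kernel_norm heta htheta h, ENNReal.ofReal_mul' (sq_nonneg _)]
  have hint : ∫⁻ z, J z = ENNReal.ofReal (x 0) * (ENNReal.ofReal (2 * Real.pi *
      (prm.theta / (prm.eta - 2) *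
        gaussHypergeometric 1 (1 - 2 / prm.eta) (2 - 2 / prm.eta) (-prm.theta))) *
      ENNReal.ofReal (1 / (Real.pi * prm.lam))) := by
    -- Tonelli: integrating over the plane first, at fixed R, leaves only the mean of R².
    rw [lintegral_const_mul _ hker.lintegral_prod_right', lintegral_lintegral_swap
      hker.aemeasurable]
    simp only [hinner]
    rw [lintegral_const_mul _ (hR.pow_const 2).ennreal_ofReal,
      hV.bs_poisson.lintegral_infDist_sq hlam]
  have hpi := Real.pi_pos
  have h2 : 0 < prm.eta - 2 := by linarith
  rw [hint, ← ENNReal.ofReal_mul' (by positivity), ← ENNReal.ofReal_mul hx,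
    ← ENNReal.ofReal_mul' (mul_nonneg hx (mul_nonneg ?_ (by positivity)))]
  · congr 2
    field_simp
  · have h1 : 2 / prm.eta < 1 := (div_lt_one (by linarith)).2 heta
    have := gaussHypergeometric_nonneg (a := 1) (b := 1 - 2 / prm.eta) (c := 2 - 2 / prm.eta)
      (z := -prm.theta) (by linarith) (by linarith) (by linarith)
    positivity

end Inter

section Outage

variable {prm : Parameters} {Ω : Type*} [mΩ : MeasurableSpace Ω] {x : BackoffState prm.N → ℝ}
  {μ : Measure Ω} {V : Variables Ω prm.N}

/-! ## Intra-cell interference -/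

/-- One minus the Laplace transform of the contribution of a device of the cell. -/
theorem IsBackoffNetwork.lintegral_intraTerm (hrho : 0 < prm.rho) (htheta : 0 < prm.theta)
    (hV : IsBackoffNetwork prm x μ V) (hx : 0 ≤ x 0) (n : ℕ) :
    ∫⁻ ω, 1 - expNeg (ENNReal.ofReal (prm.theta / prm.rho) *
        intraTerm prm (V.cellState n ω, V.cellFading n ω)) ∂μ =
      ENNReal.ofReal (x 0 * (prm.theta / (1 + prm.theta))) := by
  have := hV.prob
  have hs : 0 < prm.theta / prm.rho := by positivity
  have hψ : Measurable fun h : ℝ => 1 - expNeg (ENNReal.ofReal (prm.theta * h)) :=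
    measurable_const.sub (measurable_expNeg.comp (by fun_prop))
  have hterm : ∀ ω, 1 - expNeg (ENNReal.ofReal (prm.theta / prm.rho) *
      intraTerm prm (V.cellState n ω, V.cellFading n ω)) =
      if V.cellState n ω = 0 then
        1 - expNeg (ENNReal.ofReal (prm.theta * V.cellFading n ω)) else 0 := fun ω => by
    simp only [intraTerm]
    by_cases h0 : V.cellState n ω = 0 <;>
      simp only [h0, if_true, if_false, mul_zero, expNeg_zero, tsub_self]
    rw [← ENNReal.ofReal_mul hs.le]
    congr 3
    field_simp
  have hind : IndepFun (V.cellState n) (V.cellFading n) μ :=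
    indepFun_of_indep (hV.indep_sig (S := {.cellState n}) (T := {.cellFading n}) (by simp))
      (V.measurable_cellState (by simp)) (V.measurable_cellFading (by simp))
  simp only [hterm]
  rw [lintegral_ite_eq_mul (hV.cellState_law n).1 (hV.cellFading_law n).1 hind 0 hψ,
    (hV.cellState_law n).2, lintegral_one_sub_expNeg_exp (hV.cellFading_law n).1
    (hV.cellFading_law n).2, max_eq_left htheta.le, ← ENNReal.ofReal_mul hx]
  congr 2
  field_simp
  ring

theorem measurable_poissonMeasure_singleton (d : ℝ) (n : ℕ) :
    Measurable fun a : ℝ => poissonMeasure (d * a).toNNReal {n} := by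
  simp only [poissonMeasure_singleton]
  fun_prop

/-- Given the area a, the Poisson generating function is exp(-U a κ) with κ = 1 - z; averaging over
a is a Gamma Laplace transform. -/
theorem tsum_cellCount (hlam : 0 < prm.lam) (hdev : 0 < prm.devInt) {κ : ℝ} (hκ : 0 ≤ κ)
    {z : ENNReal} (hz : z ≤ 1) (hzκ : 1 - z = ENNReal.ofReal κ) :
    ∑' n : ℕ, z ^ n * ∫⁻ a, poissonMeasure (prm.devInt * a).toNNReal {n}
      ∂(gammaMeasure cellConst (cellConst * prm.lam)) =
      expNeg (ENNReal.ofReal (cellConst * Real.log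
        (1 + prm.devInt * κ / (cellConst * prm.lam)))) := by
  have hc := cellConst_pos
  have hr : 0 < cellConst * prm.lam := by positivity
  simp only [← lintegral_const_mul _ (measurable_poissonMeasure_singleton _ _)]
  rw [← lintegral_tsum fun n =>
    ((measurable_poissonMeasure_singleton _ n).const_mul _).aemeasurable]
  simp only [tsum_pow_mul_poissonMeasure _ hz, hzκ]
  have h1 : ∀ a : ℝ, (((prm.devInt * a).toNNReal : NNReal) : ENNReal) * ENNReal.ofReal κ =
      ENNReal.ofReal (prm.devInt * κ * a) := fun a => by
    rw [mul_right_comm, ENNReal.ofReal_mul' hκ]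
    rfl
  simp only [h1]
  have hpos : 0 ≤ prm.devInt * κ := by positivity
  have harg : 1 ≤ 1 + prm.devInt * κ / (cellConst * prm.lam) := by
    have : 0 ≤ prm.devInt * κ / (cellConst * prm.lam) := by positivity
    linarith
  rw [lintegral_expNeg_gammaMeasure hc hr, max_eq_left hpos,
    expNeg_ofReal (mul_nonneg hc.le (Real.log_nonneg harg))]
  congr 1
  have e : cellConst * prm.lam / (cellConst * prm.lam + prm.devInt * κ) =
      (1 + prm.devInt * κ / (cellConst * prm.lam))⁻¹ := by
    field_simp
  rw [e, Real.rpow_def_of_pos (inv_pos.2 (by linarith)), Real.log_inv]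
  congr 1
  ring

/-- The Laplace transform of the intra-cell interference. -/
theorem IsBackoffNetwork.lintegral_expNeg_intra (hlam : 0 < prm.lam) (hdev : 0 < prm.devInt)
    (hrho : 0 < prm.rho) (htheta : 0 < prm.theta) (hV : IsBackoffNetwork prm x μ V)
    (hx : 0 ≤ x 0) :
    ∫⁻ ω, expNeg (ENNReal.ofReal (prm.theta / prm.rho) * intraInterference prm V ω) ∂μ =
      expNeg (ENNReal.ofReal (cellConst * Real.log
        (1 + prm.theta * prm.devInt / (cellConst * prm.lam * (1 + prm.theta)) * x 0))) := by
  have := hV.prob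
  let S : ℕ → Set Source := fun n => {.cellState n, .cellFading n}
  let m : ℕ → Ω → BackoffState prm.N × ℝ := fun n ω => (V.cellState n ω, V.cellFading n ω)
  have hm : ∀ n, Measurable (m n) := fun n => (hV.cellState_law n).1.prodMk (hV.cellFading_law n).1
  -- Devices of the cell carry no location, so `Unit` takes its place in `lintegral_prod_marks`.
  let φ : Unit × BackoffState prm.N × ℝ → ENNReal := fun p =>
    expNeg (ENNReal.ofReal (prm.theta / prm.rho) * intraTerm prm p.2)
  have hφ : Measurable φ := measurable_expNeg.comp
    (measurable_const.mul ((measurable_intraTerm prm).comp measurable_snd))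
  let κ : ℝ := x 0 * (prm.theta / (1 + prm.theta))
  have hκ : 0 ≤ κ := by positivity
  have hone : ∀ n, ∫⁻ ω, 1 - φ ((), m n ω) ∂μ = ENNReal.ofReal κ := fun n =>
    hV.lintegral_intraTerm hrho htheta hx n
  have hκ1 : ENNReal.ofReal κ ≤ 1 := by
    rw [← hone 0]
    exact (lintegral_mono fun _ => tsub_le_self).trans (by simp)
  have hg : ∀ n (y : Unit), ∫⁻ ω, φ (y, m n ω) ∂μ = 1 - ENNReal.ofReal κ := fun n y => by
    rw [← hone n]
    exact lintegral_eq_one_sub (hφ.comp (measurable_const.prodMk (hm n))) fun _ =>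
      expNeg_le_one _
  have hcm : ∀ k, MeasurableSet {ω | V.cellCount ω = k} := fun k =>
    hV.cellCount_law.1 (measurableSet_singleton k)
  -- Splitting along the value k of the device count makes each product finite and deterministic in
  -- length, with the indicator as the extra factor.
  let Y : ℕ → Ω → ENNReal := fun k ω => Set.indicator {k} 1 (V.cellCount ω)
  have hYm : ∀ k (S : Set Source), Source.cellCount ∈ S → Measurable[V.sig S] (Y k) :=
    fun k S hS => (measurable_of_countable (Set.indicator {k} (1 : ℕ → ENNReal))).comp
      (V.measurable_cellCount hS)
  have hYm' : ∀ k, Measurable (Y k) := fun k =>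
    (hYm k Set.univ (Set.mem_univ _)).mono (hV.sig_le _) le_rfl
  have hYint : ∀ k : ℕ, ∫⁻ ω, Y k ω ∂μ = μ {ω | V.cellCount ω = k} := fun k => by
    rw [← lintegral_indicator_one (hcm k)]
    rfl
  have hk : ∀ k : ℕ, ∫⁻ ω, (∏ n ∈ Finset.range k, φ ((), m n ω)) * Y k ω ∂μ =
      (1 - ENNReal.ofReal κ) ^ k * μ {ω | V.cellCount ω = k} := fun k => by
    rw [lintegral_prod_marks (u := fun _ _ => ()) (A := fun n => V.sig (S n)ᶜ)
      (B := fun n => V.sig (S n)) (fun n => hV.sig_le _) (fun n => hV.sig_le _)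
      (fun n => hV.indep_sig disjoint_compl_left) (fun _ _ => measurable_const)
      (fun n => (V.measurable_cellState (by simp [S])).prodMk
        (V.measurable_cellFading (by simp [S])))
      (fun n j hj => (V.measurable_cellState (by simp [S, hj])).prodMk
        (V.measurable_cellFading (by simp [S, hj])))
      hφ hg measurable_const]
    · simp only [Finset.prod_const, Finset.card_range]
      rw [lintegral_const_mul _ (hYm' k), hYint]
    · exact fun n => hYm k _ (by simp [S])
  have hsum : ∀ ω, expNeg (ENNReal.ofReal (prm.theta / prm.rho) * intraInterference prm V ω) =
      ∑' k : ℕ, (∏ n ∈ Finset.range k, φ ((), m n ω)) * Y k ω := fun ω => by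
    have h1 : Y (V.cellCount ω) ω = 1 := by simp [Y]
    rw [tsum_eq_single (V.cellCount ω), h1, mul_one, intraInterference_eq, Finset.mul_sum,
      expNeg_sum]
    intro k hk
    have h2 : Y k ω = 0 := by simp [Y, hk.symm]
    rw [h2, mul_zero]
  simp only [hsum]
  have hprod : ∀ k : ℕ, Measurable fun ω => (∏ n ∈ Finset.range k, φ ((), m n ω)) * Y k ω :=
    fun k => (Finset.measurable_prod _ fun n _ =>
      hφ.comp (measurable_const.prodMk (hm n))).mul (hYm' k)
  rw [lintegral_tsum fun k => (hprod k).aemeasurable]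
  simp only [hk, hV.cellCount_law.2]
  rw [tsum_cellCount hlam hdev hκ tsub_le_self (ENNReal.sub_sub_cancel ENNReal.one_ne_top hκ1)]
  congr 4
  have hc := cellConst_pos
  simp only [κ]
  field_simp

/-! ## The failure probability -/

/-- Integrate out h first: at fixed D the exponential tail is exp(-D). -/
theorem measure_le_exp [IsProbabilityMeasure μ] {D : Ω → ENNReal} {h : Ω → ℝ}
    (hD : Measurable D) (hh : Measurable h) (hlaw : μ.map h = expMeasure 1)
    (hind : IndepFun D h μ) :
    μ {ω | D ω ≤ ENNReal.ofReal (h ω)} = ∫⁻ ω, expNeg (D ω) ∂μ := by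
  have hE : MeasurableSet {p : ENNReal × ℝ | p.1 ≤ ENNReal.ofReal p.2} :=
    measurableSet_le measurable_fst measurable_snd.ennreal_ofReal
  have h0 : MeasurableSet {ω | D ω ≤ ENNReal.ofReal (h ω)} :=
    measurableSet_le hD hh.ennreal_ofReal
  have h1 := lintegral_indepFun hD hh hind
    (H := {p : ENNReal × ℝ | p.1 ≤ ENNReal.ofReal p.2}.indicator 1) (measurable_one.indicator hE)
  rw [← lintegral_indicator_one h0]
  refine h1.trans (lintegral_congr fun ω => ?_)
  have h2 : MeasurableSet {t : ℝ | D ω ≤ ENNReal.ofReal t} :=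
    measurableSet_le measurable_const measurable_id.ennreal_ofReal
  rw [← expMeasure_le_ofReal, ← hlaw, Measure.map_apply hh h2, ← lintegral_indicator_one (hh h2)]
  rfl

theorem ae_pos_of_exp {h : Ω → ℝ} (hh : Measurable h) (hlaw : μ.map h = expMeasure 1) :
    ∀ᵐ ω ∂μ, 0 < h ω := by
  have h1 : μ (h ⁻¹' Set.Iic 0) = 0 := by
    have := isProbabilityMeasure_expMeasure one_pos
    rw [← Measure.map_apply hh measurableSet_Iic, hlaw, ← measureReal_eq_zero_iff, ← cdf_eq_real,
      cdf_expMeasure_eq one_pos]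
    simp
  filter_upwards [measure_eq_zero_iff_ae_notMem.1 h1] with ω h
  exact not_le.1 h

/-- A positive signal excludes the quotient 0/0, which is 0 by convention and would count as a
failure while the right-hand inequality holds. The exceptional event is null. -/
theorem not_sinr_lt_iff {Ω : Type*} (hrho : 0 < prm.rho) (V : Variables Ω prm.N) {ω : Ω}
    (hω : 0 < V.signal ω) :
    ¬ sinr prm V ω < ENNReal.ofReal prm.theta ↔
      ENNReal.ofReal (prm.theta / prm.rho) * (ENNReal.ofReal prm.noise +
        intraInterference prm V ω + interInterference prm V ω) ≤ ENNReal.ofReal (V.signal ω) := by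
  have h0 : ENNReal.ofReal (prm.rho * V.signal ω) ≠ 0 := by
    have : 0 < prm.rho * V.signal ω := by positivity
    simpa using this
  have e : ENNReal.ofReal prm.theta =
      ENNReal.ofReal prm.rho * ENNReal.ofReal (prm.theta / prm.rho) := by
    rw [← ENNReal.ofReal_mul hrho.le]
    congr 1
    field_simp
  rw [sinr, ENNReal.div_lt_iff (Or.inr h0) (Or.inr ENNReal.ofReal_ne_top), not_lt, e,
    ENNReal.ofReal_mul hrho.le, mul_assoc,
    ENNReal.mul_le_mul_iff_right (by simpa using hrho) ENNReal.ofReal_ne_top]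

/-- The success probability is a Laplace transform of the noise plus interference. -/
theorem IsBackoffNetwork.measure_not_sinr_lt (hrho : 0 < prm.rho)
    (hV : IsBackoffNetwork prm x μ V) :
    μ {ω | sinr prm V ω < ENNReal.ofReal prm.theta}ᶜ =
      ∫⁻ ω, expNeg (ENNReal.ofReal (prm.theta / prm.rho) * (ENNReal.ofReal prm.noise +
        intraInterference prm V ω + interInterference prm V ω)) ∂μ := by
  have := hV.prob
  obtain ⟨S, hS⟩ : ∃ S : Set Source, S = {Source.signal}ᶜ := ⟨_, rfl⟩
  have hDm : Measurable[V.sig S] fun ω => ENNReal.ofReal (prm.theta / prm.rho) *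
      (ENNReal.ofReal prm.noise + intraInterference prm V ω + interInterference prm V ω) := by
    refine Measurable.const_mul (Measurable.add (Measurable.add measurable_const
      (measurable_intraInterference V ?_ ?_ ?_)) (measurable_interInterference V ?_ ?_ ?_ ?_)) _
    all_goals simp [hS]
  have hdisj : Disjoint S {Source.signal} := hS ▸ disjoint_compl_left
  have hind := indepFun_of_indep (hV.indep_sig hdisj) hDm
    (V.measurable_signal (S := {Source.signal}) rfl)
  rw [← measure_le_exp (hDm.mono (hV.sig_le S) le_rfl) hV.signal_law.1 hV.signal_law.2 hind]
  refine measure_congr (eventuallyEq_set.2 ?_)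
  filter_upwards [ae_pos_of_exp hV.signal_law.1 hV.signal_law.2] with ω hω
  exact not_sinr_lt_iff hrho V hω

/-- The failure probability is given by the closed form. -/
theorem IsBackoffNetwork.failureProbability_eq (hlam : 0 < prm.lam) (hdev : 0 < prm.devInt)
    (hrho : 0 < prm.rho) (htheta : 0 < prm.theta) (hnoise : 0 ≤ prm.noise) (heta : 2 < prm.eta)
    (hV : IsBackoffNetwork prm x μ V) (hx : 0 ≤ x 0) :
    failureProbability prm μ V = closedForm prm (x 0) := by
  have := hV.prob
  have hs : 0 ≤ prm.theta / prm.rho := by positivity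
  -- The intra-cell sources; the inter-cell interference depends only on the complement, so the two
  -- transforms multiply.
  let S : Set Source := {.cellCount} ∪ (Set.range .cellState ∪ Set.range .cellFading)
  have hintra : Measurable[V.sig S] (intraInterference prm V) :=
    measurable_intraInterference V (by simp [S]) (by simp [S]) (by simp [S])
  have hinter : Measurable[V.sig Sᶜ] (interInterference prm V) :=
    measurable_interInterference V (by simp [S]) (by simp [S]) (by simp [S]) (by simp [S])
  have hintra' := hintra.mono (hV.sig_le _) le_rfl
  have hinter' := hinter.mono (hV.sig_le _) le_rfl
  have hmul := lintegral_mul_eq_lintegral_mul_lintegral_of_independent_measurableSpace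
    (hV.sig_le S) (hV.sig_le Sᶜ) (hV.indep_sig disjoint_compl_right)
    (measurable_expNeg.comp (hintra.const_mul (ENNReal.ofReal (prm.theta / prm.rho))))
    (measurable_expNeg.comp (hinter.const_mul (ENNReal.ofReal (prm.theta / prm.rho))))
  simp only [Function.comp_def] at hmul
  have hsplit : ∀ ω, expNeg (ENNReal.ofReal (prm.theta / prm.rho) * (ENNReal.ofReal prm.noise +
        intraInterference prm V ω + interInterference prm V ω)) =
      expNeg (ENNReal.ofReal (prm.theta / prm.rho * prm.noise)) *
        (expNeg (ENNReal.ofReal (prm.theta / prm.rho) * intraInterference prm V ω) *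
          expNeg (ENNReal.ofReal (prm.theta / prm.rho) * interInterference prm V ω)) := fun ω => by
    rw [← expNeg_add, ← expNeg_add, ENNReal.ofReal_mul hs]
    congr 1
    ring
  have hm := hV.measure_not_sinr_lt hrho
  simp only [hsplit] at hm
  have hprod : Measurable fun ω =>
      expNeg (ENNReal.ofReal (prm.theta / prm.rho) * intraInterference prm V ω) *
        expNeg (ENNReal.ofReal (prm.theta / prm.rho) * interInterference prm V ω) :=
    (measurable_expNeg.comp (hintra'.const_mul _)).mul
      (measurable_expNeg.comp (hinter'.const_mul _))
  rw [lintegral_const_mul _ hprod, hmul,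
    hV.lintegral_expNeg_intra hlam hdev hrho htheta hx,
    hV.lintegral_expNeg_inter hlam hrho htheta heta hx, ← expNeg_add, ← expNeg_add] at hm
  have hb := mul_nonneg (exponent_coeff_nonneg hlam hdev htheta heta) hx
  have hl := mul_nonneg cellConst_pos.le
    (Real.log_nonneg (exponent_arg_pos hlam hdev htheta hx))
  have hn : 0 ≤ prm.theta / prm.rho * prm.noise := by positivity
  rw [← ENNReal.ofReal_add hl hb, ← ENNReal.ofReal_add hn (add_nonneg hl hb),
    expNeg_ofReal (by positivity)] at hm
  have hsm : MeasurableSet {ω | sinr prm V ω < ENNReal.ofReal prm.theta} := by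
    refine measurableSet_lt ?_ measurable_const
    exact (hV.signal_law.1.const_mul _).ennreal_ofReal.div
      ((measurable_const.add hintra').add hinter')
  have hc := probReal_compl_eq_one_sub (μ := μ) hsm
  rw [measureReal_def, hm, ENNReal.toReal_ofReal (Real.exp_pos _).le] at hc
  rw [failureProbability, closedForm_eq_exp hlam hdev htheta hx]
  have e : -outageExponent prm (x 0) = -(prm.theta / prm.rho * prm.noise + (cellConst * Real.log
        (1 + prm.theta * prm.devInt / (cellConst * prm.lam * (1 + prm.theta)) * x 0) +
      2 * prm.theta * prm.devInt / ((prm.eta - 2) * prm.lam) *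
        gaussHypergeometric 1 (1 - 2 / prm.eta) (2 - 2 / prm.eta) (-prm.theta) * x 0)) := by
    rw [outageExponent]; ring
  rw [e]
  linarith

end Outage

end Rach

end

/-! ### Assembly of the closed form and the fixed-point analysis. -/

theorem theorem3 (prm : Rach.Parameters)
    (hlam : 0 < prm.lam) (hdev : 0 < prm.devInt) (hrho : 0 < prm.rho) (htheta : 0 < prm.theta)
    (hnoise : 0 ≤ prm.noise) (heta : 2 < prm.eta) (hq : 0 < prm.q) (hq' : prm.q ≤ 1) :
    -- closed form of the failure probability, for a given state probability vector
    (∀ x ∈ stdSimplex ℝ (Rach.BackoffState prm.N),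
      ∀ (Ω : Type*) [MeasurableSpace Ω] (μ : Measure Ω) (V : Rach.Variables Ω prm.N),
        Rach.IsBackoffNetwork prm x μ V →
          Rach.failureProbability prm μ V = Rach.closedForm prm (x 0)) ∧
    -- the self-consistent steady state vector, and its computation
    ∃ xStar ∈ stdSimplex ℝ (Rach.BackoffState prm.N),
      Rach.IsSteadyState
        (Rach.backoffMatrix prm.N prm.q (Rach.closedForm prm (xStar 0))) xStar ∧
      (∀ y ∈ stdSimplex ℝ (Rach.BackoffState prm.N),
        Rach.IsSteadyState (Rach.backoffMatrix prm.N prm.q (Rach.closedForm prm (y 0))) y →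
          y = xStar) ∧
      -- a system in equilibrium with its own failure probability has state vector `xStar`
      (∀ x ∈ stdSimplex ℝ (Rach.BackoffState prm.N),
        ∀ (Ω : Type*) [MeasurableSpace Ω] (μ : Measure Ω) (V : Rach.Variables Ω prm.N),
          Rach.IsBackoffNetwork prm x μ V →
          Rach.IsSteadyState
            (Rach.backoffMatrix prm.N prm.q (Rach.failureProbability prm μ V)) x →
          x = xStar) ∧
      -- from every initial probability vector, the algorithm computes `xStar`
      ∀ xInit ∈ stdSimplex ℝ (Rach.BackoffState prm.N),
        (∃! xs, Rach.IsIterates prm xInit xs) ∧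
        (∀ xs, Rach.IsIterates prm xInit xs → Tendsto xs atTop (𝓝 xStar)) ∧
        (∀ ε > 0, ∃! y, Rach.AlgorithmReturns prm ε xInit y) ∧
        ∀ δ > 0, ∃ ε₀ > 0, ∀ ε, 0 < ε → ε < ε₀ →
          ∀ y, Rach.AlgorithmReturns prm ε xInit y → ‖y - xStar‖ < δ := by
  obtain ⟨xStar, hmem, hst, huniq, halg⟩ := Rach.exists_selfConsistent
    (Rach.isFailureCurve_closedForm hlam hdev hrho htheta hnoise heta) hq
  refine ⟨fun x hx Ω _ μ V hV => hV.failureProbability_eq hlam hdev hrho htheta hnoise heta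
    (hx.1 0), xStar, hmem, hst, huniq, fun x hx Ω _ μ V hV hs => huniq x hx ?_, halg⟩
  -- By part (i), equilibrium with the actual failure probability is self-consistency for the closed
  -- form.
  rwa [hV.failureProbability_eq hlam hdev hrho htheta hnoise heta (hx.1 0)] at hs
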